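/- Let $V$ be a Euclidean vector space of dimension $n\ge 2$, let $m\ge 1$ be an integer, and let $\Delta=-\sum_i\partial_i^2$ be the (positive) Laplace operator on $V$. Write $\mathscr D(V)$ for the complex-valued test functions, $\mathscr D'(V)$ for the distributions, $\mathscr E(V)=C^\infty(V)$ with its usual topology, and $\mathscr E'(V)$ for its dual, the compactly supported distributions. For $t>0$ let $$e_t^m(v)=(2\pi)^{-n}\int_V e^{i\langle v,\xi\rangle-t|\xi|^{2m}}\,d\xi .$$ For $\mathrm{Re}(\alpha)>0$, $\alpha\notin n+2\mathbb N_0$, let $I_\alpha$ be the distribution given by the locally integrable function $$I_\alpha(v)=\frac{\Gamma(\frac{n-\alpha}{2})}{2^\alpha\pi^{n/2}\Gamma(\frac{\alpha}{2})}\,|v|^{\alpha-n},$$ and for $\mathrm{Re}(\alpha)\le 0$ let $I_\alpha[\varphi]$ be its meromorphic continuation $I_{\alpha+2k}[\Delta^k\varphi]$, $k\in\mathbb N$, $\mathrm{Re}(\alpha)+2k>0$ (with removable singularities in $\alpha$ filled in). For $\mathrm{Re}(\alpha)>0$ define $$E_{m,\alpha}[\varphi]=\frac1{\Gamma(\alpha)}\int_0^1\Bigl(\int_V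 e_t^m(v)\varphi(v)\,dv\Bigr)t^{\alpha-1}\,dt,\qquad \varphi\in\mathscr D(V),$$ where the $t$-integral converges absolutely. Then: (1) $\alpha\mapsto E_{m,\alpha}$ extends uniquely to an entire family with values in $\mathscr D'(V)$, meaning that $\alpha\mapsto E_{m,\alpha}[\varphi]$ is entire for every $\varphi\in\mathscr D(V)$. (2) The difference $\Psi_{m,\alpha}:=E_{m,\alpha}-I_{2m\alpha}$ is a smooth function for every $\alpha\in\mathbb C$ with $2m\alpha\notin n+2\mathbb N_0$. If $2m\alpha_0\in n+2\mathbb N_0$, the finite part of $\Psi_{m,\alpha}$ at $\alpha=\alpha_0$ (the constant term of the Laurent expansion of $\alpha\mapsto\Psi_{m,\alpha}[\varphi]$ at $\alpha_0$) is a smooth function as well. (3) $\alpha\mapsto\Psi_{m,\alpha}$ is meromorphic on $\mathbb C$ with values in $\mathscr E(V)$, meaning that for every $T\in\mathscr E'(V)$ the function $\alpha\mapsto T(\Psi_{m,\alpha})$ is meromorphic on $\mathbb C$; it is holomorphic away from the points with $2m\alpha\in n+2\mathbb N_0$. (4) As an equality of meromorphic functions of $\alpha$ (and pointwise for all $\alpha$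 with $2m\alpha\notin n+2\mathbb N_0$), $$\Psi_{m,\alpha}(0)=\delta_0(\Psi_{m,\alpha})=\frac{\Gamma(\frac{n}{2m})}{(4\pi)^{n/2}\,\Gamma(\frac n2)\,\Gamma(\alpha)}\cdot\frac{1}{m\alpha-\frac n2}.$$ -/

import Mathlib

open MeasureTheory TopologicalSpace Filter Topology
open scoped ContDiff Distributions

noncomputable section

/-- The space `C^∞(V)` of smooth complex-valued functions on `V`, as a linear subspace of all
functions. -/
def smoothSubmodule (V : Type*) [NormedAddCommGroup V] [NormedSpace ℝ V] :
    Submodule ℂ (V → ℂ) where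
  carrier := {f | ContDiff ℝ ∞ f}
  add_mem' := by
    intro f g hf hg
    have hf' : ContDiff ℝ ∞ f := hf
    exact hf'.add hg
  zero_mem' := by
    change ContDiff ℝ ∞ fun _ : V => (0 : ℂ)
    exact contDiff_const
  smul_mem' := by
    intro c f hf
    have hf' : ContDiff ℝ ∞ f := hf
    exact hf'.const_smul c

/-- The space `ℰ(V) = C^∞(V)`. It is a separate type (and not the coercion of the submodule) since
it carries its own topology, defined below. -/
def SmoothFun (V : Type*) [NormedAddCommGroup V] [NormedSpace ℝ V] : Type _ :=
  ↥(smoothSubmodule V)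

namespace SmoothFun

variable {V : Type*} [NormedAddCommGroup V] [NormedSpace ℝ V]

instance : AddCommGroup (SmoothFun V) := inferInstanceAs (AddCommGroup ↥(smoothSubmodule V))

instance : Module ℂ (SmoothFun V) := inferInstanceAs (Module ℂ ↥(smoothSubmodule V))

instance : CoeFun (SmoothFun V) (fun _ => V → ℂ) := ⟨fun f => f.1⟩

theorem contDiff (f : SmoothFun V) : ContDiff ℝ ∞ (f : V → ℂ) := f.2

/-- The `j`-th derivative of a smooth function, as a continuous function. -/
def deriv (j : ℕ) (f : SmoothFun V) : C(V, V [×j]→L[ℝ] ℂ) where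
  toFun := iteratedFDeriv ℝ j f
  continuous_toFun := f.contDiff.continuous_iteratedFDeriv (by exact_mod_cast le_top)

/-- The usual topology of `ℰ(V)`: uniform convergence on compact sets of the functions and of all
their derivatives. -/
instance : TopologicalSpace (SmoothFun V) :=
  ⨅ j : ℕ, TopologicalSpace.induced (deriv j) inferInstance

end SmoothFun

/-- The space `ℰ'(V)` of compactly supported distributions: the continuous linear functionals on
`ℰ(V)`. -/
abbrev CompactDistribution (V : Type*) [NormedAddCommGroup V] [NormedSpace ℝ V] : Type _ :=
  SmoothFun V →L[ℂ] ℂ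

/-- The delta distribution at `0`, as an element of `ℰ'(V)`. -/
def diracZero (V : Type*) [NormedAddCommGroup V] [NormedSpace ℝ V] : CompactDistribution V where
  toFun f := f 0
  map_add' _ _ := rfl
  map_smul' _ _ := rfl
  cont := by
    have h0 : Continuous (SmoothFun.deriv (V := V) 0) :=
      continuous_iff_le_induced.2 (iInf_le _ 0)
    have h1 : Continuous fun f : SmoothFun V =>
        (SmoothFun.deriv 0 f) 0 (fun i : Fin 0 => i.elim0) :=
      (continuous_eval_const (fun i : Fin 0 => (i.elim0 : V))).comp
        ((continuous_eval_const (0 : V)).comp h0)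
    exact h1

/-- The space `𝒟(V)` of complex-valued test functions, with its usual (LF) topology. -/
abbrev TestFun (V : Type*) [NormedAddCommGroup V] [NormedSpace ℝ V] : Type _ :=
  𝓓((⊤ : Opens V), ℂ)

/-- The space `𝒟'(V)` of distributions: the continuous complex-linear functionals on `𝒟(V)`. -/
abbrev Distr (V : Type*) [NormedAddCommGroup V] [NormedSpace ℝ V] : Type _ :=
  TestFun V →L[ℂ] ℂ

/-- `c` is the finite part at `a` of the function `f`, meromorphic near `a`: the constant term of
the Laurent expansion of `f` at `a`, whose principal part is a polynomial without constant term
in `(z - a)⁻¹`. -/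
def HasFinitePartAt (f : ℂ → ℂ) (a c : ℂ) : Prop :=
  ∃ (p : Polynomial ℂ) (g : ℂ → ℂ), p.coeff 0 = 0 ∧ AnalyticAt ℂ g a ∧ g a = c ∧
    ∀ᶠ z in 𝓝[≠] a, f z = p.eval ((z - a)⁻¹) + g z

section Euclidean

variable {V : Type*} [NormedAddCommGroup V] [InnerProductSpace ℝ V] [FiniteDimensional ℝ V]
  [MeasurableSpace V] [BorelSpace V]

/-- The constant `C(α, n)`. -/
def rieszConst (n : ℕ) (α : ℂ) : ℂ :=
  Complex.Gamma ((n - α) / 2) /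
    ((2 : ℂ) ^ α * (Real.pi : ℂ) ^ ((n : ℂ) / 2) * Complex.Gamma (α / 2))

/-- The Riesz potential `I_α(v) = C(α, n) |v| ^ (α - n)`. -/
def rieszPotential (α : ℂ) (v : V) : ℂ :=
  rieszConst (Module.finrank ℝ V) α * (‖v‖ : ℂ) ^ (α - Module.finrank ℝ V)

/-- The positive Laplace operator `- ∑ i, ∂ i ^ 2`. -/
def posLaplacian (f : V → ℂ) : V → ℂ := fun v => - Laplacian.laplacian f v

/-- The Riesz distributions `I_α[φ]`. For `Re α > 0` this is integration against the locally
integrable function `I_α` (the values at the poles `α = n, n + 2, n + 4, …` carry no meaning).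
For `Re α ≤ 0`, it is the meromorphic continuation `I_{α + 2k}[Δ^k φ]`, with `k` the
least natural number with `Re α + 2 k > 0`. It is written as a limit `β → α`, which only matters
if `α + 2 k = n` is a pole (possible only for `n ≤ 2`), where the singularity in `β`
is removable. -/
def rieszDistribution (α : ℂ) (φ : V → ℂ) : ℂ :=
  if 0 < α.re then ∫ v, rieszPotential α v * φ v
  else limUnder (𝓝[≠] α) fun β : ℂ =>
    ∫ v, rieszPotential (β + 2 * ((⌊-α.re / 2⌋₊ + 1 : ℕ) : ℂ)) v *
      (posLaplacian^[⌊-α.re / 2⌋₊ + 1] φ) v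

/-- The heat kernel of `Δ ^ m`:
`e_t^m(v) = (2π)^{-n} ∫ exp (i ⟨v, ξ⟩ - t |ξ| ^ (2 m)) dξ`. -/
def heatKernel (m : ℕ) (t : ℝ) (v : V) : ℂ :=
  ((2 * Real.pi : ℝ) : ℂ)⁻¹ ^ Module.finrank ℝ V *
    ∫ ξ : V, Complex.exp (Complex.I * (inner ℝ v ξ : ℝ) - ((t * ‖ξ‖ ^ (2 * m) : ℝ) : ℂ))

/-- The integrand `(e_t^m, φ)_{L²} t ^ (α - 1)`. -/
def heatIntegrand (m : ℕ) (α : ℂ) (φ : V → ℂ) (t : ℝ) : ℂ :=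
  (∫ v, heatKernel m t v * φ v) * (t : ℂ) ^ (α - 1)

/-- `E_{m,α}[φ] = Γ(α)⁻¹ ∫_0^1 (e_t^m, φ)_{L²} t ^ (α - 1) dt`, meaningful for `Re α > 0`. -/
def heatMellin (m : ℕ) (α : ℂ) (φ : V → ℂ) : ℂ :=
  (Complex.Gamma α)⁻¹ * ∫ t in (0 : ℝ)..1, heatIntegrand m α φ t

/-- `E` is an entire family of distributions which agrees with `E_{m,α}` for `Re α > 0`. -/
def IsEntireExtension (m : ℕ) (E : ℂ → Distr V) : Prop :=
  (∀ φ : TestFun V, Differentiable ℂ fun α => E α φ) ∧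
    ∀ α : ℂ, 0 < α.re → ∀ φ : TestFun V, E α φ = heatMellin m α φ

/-- The difference `Ψ_{m,α}[φ] = E_{m,α}[φ] - I_{2mα}[φ]`. -/
def heatRieszDiff (m : ℕ) (E : ℂ → Distr V) (α : ℂ) (φ : TestFun V) : ℂ :=
  E α φ - rieszDistribution (2 * m * α) φ

end Euclidean

/-- `α` is one of the points with `2 m α = n + 2 k`, `k = 0, 1, 2, …`. -/
def IsExceptional (n m : ℕ) (α : ℂ) : Prop := ∃ k : ℕ, 2 * m * α = n + 2 * k

end

set_option linter.unusedSectionVars false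

open Module SchwartzMap

/-! Let `n = dim V` and let `g` be the Fourier transform of `φ`, normalised so that `(e_t^m, φ) = ∫
exp(-t|ξ|^(2m)) g(ξ) dξ`. For `0 < Re α < n/(2m)` the Mellin integral over all of `(0, ∞)` converges
and equals `Γ(α) ∫ |ξ|^(-2mα) g(ξ) dξ` (`hasMellin_expPairing`). The last integral is `I_{2mα}[φ]`
(`rieszConst_mul_radialMoment`), by the same computation with `m = 1`, where the heat kernel is an
explicit Gaussian. Hence `Ψ_{m,α}` is minus the missing piece `Γ(α)⁻¹ ∫_1^∞ (e_t^m, φ) t^(α-1) dt`.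

By rotation invariance and scaling, `e_t^m(v) = ∑ c_k t^(-(n+2k)/(2m)) |v|^(2k)`, where `∑ c_k z^k`
is entire (`hasSum_heatKernel`). Termwise integration over `t > 1` gives `Ψ_{m,α}(v) = -(2m/Γ(α)) ∑
c_k |v|^(2k) / (n + 2k - 2mα)`. The right side makes sense for every `α` with `2mα ∉ n + 2ℕ`, is
smooth in `v`, and has at most simple poles in `α`. Its value at `v = 0` is the term `k = 0`, with
`c_0 = e_1^m(0)` a Gamma integral.

Two continuations finish the proof. The entire family is the defining integral for `Re α > 0` and `∫
|ξ|^(-2mα) g + ∫ Ψ φ` for `2m Re α < n`; these agree on the overlap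
(`heatMellin_eq_radialMoment_add`). The identity `E - I = Ψ`, known on a strip, spreads by the
identity theorem for meromorphic functions (`eventually_rieszPotential_eq`).

Functionals `T` on `C^∞(V)` enter only through their values on functions `f(|v|²)` with `f` entire,
where a bound by the maximum of `f` on a disk is enough (`IsRadiallyBounded`). Elements of `ℰ'(V)`
and pairings with test functions are thus handled by one argument. -/

/-- Bounding a power of a positive real by the powers with the extreme exponents. -/
theorem Real.rpow_le_rpow_add_rpow {y a lo hi : ℝ} (hy : 0 < y) (h1 : lo ≤ a) (h2 : a ≤ hi) :
    y ^ a ≤ y ^ lo + y ^ hi := by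
  rcases le_total y 1 with h | h
  · exact (Real.rpow_le_rpow_of_exponent_ge hy h h1).trans
      (le_add_of_nonneg_right (Real.rpow_nonneg hy.le _))
  · exact (Real.rpow_le_rpow_of_exponent_le h h2).trans
      (le_add_of_nonneg_left (Real.rpow_nonneg hy.le _))

/-- Differentiating `‖x‖ ^ z` in `z` produces a logarithm; trading it for small powers keeps the
dominating function integrable. -/
theorem Real.abs_log_le_rpow_add_rpow {y ε : ℝ} (hy : 0 < y) (hε : 0 < ε) :
    |Real.log y| ≤ (y ^ ε + y ^ (-ε)) / ε := by
  have h1 := Real.log_le_rpow_div hy.le hε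
  have h2 := Real.log_le_rpow_div (inv_nonneg.2 hy.le) hε
  rw [Real.log_inv, Real.inv_rpow hy.le, ← Real.rpow_neg hy.le] at h2
  have h3 : 0 ≤ y ^ ε / ε := by positivity
  have h4 : 0 ≤ y ^ (-ε) / ε := by positivity
  rw [add_div, abs_le]
  constructor <;> linarith

/-! ### Radial moments `∫ |x|^(s-d) h(x) dx` of Schwartz functions. -/

section RadialMoment

variable {V : Type*} [NormedAddCommGroup V] [InnerProductSpace ℝ V] [FiniteDimensional ℝ V]
  [MeasurableSpace V] [BorelSpace V]

theorem SchwartzMap.exists_norm_le_one_add_rpow (k : ℕ) :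
    ∃ (s : Finset (ℕ × ℕ)) (C : ℝ), 0 ≤ C ∧ ∀ (h : 𝓢(V, ℂ)) (x : V),
      ‖h x‖ ≤ C * s.sup (schwartzSeminormFamily ℂ V ℂ) h * (1 + ‖x‖) ^ (-(k : ℝ)) := by
  refine ⟨Finset.Iic (k, 0), 2 ^ k, by positivity, fun h x => ?_⟩
  have := one_add_le_sup_seminorm_apply (𝕜 := ℂ) (m := (k, 0)) le_rfl le_rfl h x
  rw [norm_iteratedFDeriv_zero] at this
  rw [Real.rpow_neg (by positivity), Real.rpow_natCast, ← div_eq_mul_inv,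
    le_div_iff₀ (by positivity), mul_comm]
  exact this

/-- In polar coordinates this is a one-dimensional Mellin integral: `0 < σ` gives convergence at the
origin, `σ < k` at infinity. -/
theorem integrable_rpow_norm_mul_one_add_rpow [Nontrivial V] {σ k : ℝ} (hσ : 0 < σ)
    (hk : σ < k) :
    Integrable fun x : V => ‖x‖ ^ (σ - finrank ℝ V) * (1 + ‖x‖) ^ (-k) := by
  have hd : 0 < finrank ℝ V := finrank_pos
  rw [integrable_fun_norm_addHaar (volume : Measure V)
    (f := fun y : ℝ => y ^ (σ - finrank ℝ V) * (1 + y) ^ (-k))]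
  have key : IntegrableOn (fun t : ℝ => t ^ (σ - 1) * (1 + t) ^ (-k)) (Set.Ioi 0) := by
    have hcont : ContinuousOn (fun t : ℝ => (1 + t) ^ (-k)) (Set.Ioi 0) := by
      intro t ht
      have : (1 : ℝ) + t ≠ 0 := by have : 0 < t := ht; positivity
      exact ((continuousAt_const.add continuousAt_id).rpow_const (Or.inl this)).continuousWithinAt
    refine mellin_convergent_of_isBigO_scalar (a := k) (b := 0)
      (hcont.locallyIntegrableOn measurableSet_Ioi) ?_ hk ?_ hσ
    · refine Asymptotics.IsBigO.of_bound 1 ?_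
      filter_upwards [eventually_gt_atTop 0] with t ht
      rw [one_mul, Real.norm_of_nonneg (by positivity), Real.norm_of_nonneg (by positivity)]
      exact Real.rpow_le_rpow_of_nonpos ht (by linarith) (by linarith)
    · refine Asymptotics.IsBigO.of_bound 1 ?_
      filter_upwards [self_mem_nhdsWithin] with t ht
      have ht : 0 < t := ht
      rw [neg_zero, Real.rpow_zero, norm_one, one_mul, Real.norm_of_nonneg (by positivity)]
      exact Real.rpow_le_one_of_one_le_of_nonpos (by linarith) (by linarith)
  refine key.congr_fun (fun y hy => ?_) measurableSet_Ioi
  have hy : 0 < y := hy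
  simp only [smul_eq_mul]
  rw [← mul_assoc, ← Real.rpow_natCast, ← Real.rpow_add hy, Nat.cast_sub hd]
  congr 2
  push_cast
  ring

variable (V) in
theorem ae_norm_pos [Nontrivial V] : ∀ᵐ x : V, 0 < ‖x‖ := by
  have : ∀ᵐ x : V, x ≠ 0 := by
    rw [ae_iff]; simp
  filter_upwards [this] with x hx using norm_pos_iff.2 hx

theorem SchwartzMap.integrable_rpow_norm_mul_norm [Nontrivial V] (h : 𝓢(V, ℂ)) {σ : ℝ}
    (hσ : 0 < σ) : Integrable fun x : V => ‖x‖ ^ (σ - finrank ℝ V) * ‖h x‖ := by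
  obtain ⟨k, hk⟩ := exists_nat_gt σ
  obtain ⟨s, C, hC, hb⟩ := SchwartzMap.exists_norm_le_one_add_rpow (V := V) k
  refine ((integrable_rpow_norm_mul_one_add_rpow hσ hk).const_mul
    (C * s.sup (schwartzSeminormFamily ℂ V ℂ) h)).mono' ?_ ?_
  · exact ((measurable_norm.pow_const _).mul h.continuous.measurable.norm).aestronglyMeasurable
  · refine ae_of_all _ fun x => ?_
    rw [Real.norm_of_nonneg (by positivity)]
    calc _ ≤ ‖x‖ ^ (σ - finrank ℝ V) *
        (C * s.sup (schwartzSeminormFamily ℂ V ℂ) h * (1 + ‖x‖) ^ (-(k : ℝ))) := by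
          gcongr; exact hb h x
      _ = _ := by ring

/-- The moment `∫ |x| ^ (s - d) h(x) dx` of a function on a Euclidean space of dimension `d`. -/
noncomputable def radialMoment (h : V → ℂ) (s : ℂ) : ℂ :=
  ∫ x : V, (‖x‖ : ℂ) ^ (s - finrank ℝ V) * h x

theorem aestronglyMeasurable_cpow_norm_mul (h : 𝓢(V, ℂ)) (s : ℂ) :
    AEStronglyMeasurable (fun x : V => (‖x‖ : ℂ) ^ s * h x) := by
  refine (Measurable.mul ?_ h.continuous.measurable).aestronglyMeasurable
  exact (Complex.measurable_ofReal.comp measurable_norm).pow_const _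

theorem norm_cpow_norm_mul {x : V} (hx : 0 < ‖x‖) (s : ℂ) (c : ℂ) :
    ‖(‖x‖ : ℂ) ^ (s - finrank ℝ V) * c‖ = ‖x‖ ^ (s.re - finrank ℝ V) * ‖c‖ := by
  rw [norm_mul, Complex.norm_cpow_eq_rpow_re_of_pos hx]
  simp

theorem SchwartzMap.integrable_cpow_norm_mul [Nontrivial V] (h : 𝓢(V, ℂ)) {s : ℂ}
    (hs : 0 < s.re) : Integrable fun x : V => (‖x‖ : ℂ) ^ (s - finrank ℝ V) * h x := by
  refine (h.integrable_rpow_norm_mul_norm hs).mono' (aestronglyMeasurable_cpow_norm_mul h _) ?_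
  filter_upwards [ae_norm_pos V] with x hx using (norm_cpow_norm_mul hx s _).le

theorem differentiableAt_radialMoment [Nontrivial V] (h : 𝓢(V, ℂ)) {s : ℂ} (hs : 0 < s.re) :
    DifferentiableAt ℂ (radialMoment h) s := by
  set d : ℝ := ((finrank ℝ V : ℕ) : ℝ) with hd
  set σ := s.re with hσ
  set ε := σ / 4 with hε
  have hε0 : 0 < ε := by positivity
  set F' : ℂ → V → ℂ := fun z x => (‖x‖ : ℂ) ^ (z - finrank ℝ V) * (Real.log ‖x‖ : ℂ) * h x
  -- For `|z - s| < ε = σ/4` the exponents `Re z ± ε` lie in `[σ/2, 2σ]`; both endpoints are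
  -- positive, so both moments converge.
  set bound : V → ℝ := fun x => 2 / ε * (‖x‖ ^ (σ / 2 - d) * ‖h x‖ + ‖x‖ ^ (2 * σ - d) * ‖h x‖)
  have hF'_meas : AEStronglyMeasurable (F' s) volume := by
    refine (Measurable.mul (Measurable.mul ?_ ?_) h.continuous.measurable).aestronglyMeasurable
    · exact (Complex.measurable_ofReal.comp measurable_norm).pow_const _
    · exact Complex.measurable_ofReal.comp (Real.measurable_log.comp measurable_norm)
  have key := hasDerivAt_integral_of_dominated_loc_of_deriv_le (μ := (volume : Measure V))
    (F := fun (z : ℂ) (x : V) => (‖x‖ : ℂ) ^ (z - finrank ℝ V) * h x) (x₀ := s) (F' := F')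
    (bound := bound) (Metric.ball_mem_nhds s hε0)
    (Eventually.of_forall fun z => aestronglyMeasurable_cpow_norm_mul h _)
    (h.integrable_cpow_norm_mul hs) hF'_meas ?_ ?_ ?_
  · exact key.2.differentiableAt
  · filter_upwards [ae_norm_pos V] with x hx z hz
    have hz' : |z.re - σ| < ε := by
      refine lt_of_le_of_lt ?_ (mem_ball_iff_norm.1 hz)
      rw [hσ, ← Complex.sub_re]
      exact Complex.abs_re_le_norm _
    rw [abs_lt] at hz'
    have e1 : ‖F' z x‖ = ‖x‖ ^ (z.re - d) * |Real.log ‖x‖| * ‖h x‖ := by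
      simp only [F']
      rw [mul_assoc, norm_cpow_norm_mul hx, norm_mul, Complex.norm_real, Real.norm_eq_abs, mul_assoc]
    rw [e1]
    have e2 : ‖x‖ ^ (z.re - d) * |Real.log ‖x‖| ≤
        2 / ε * (‖x‖ ^ (σ / 2 - d) + ‖x‖ ^ (2 * σ - d)) := by
      calc _ ≤ ‖x‖ ^ (z.re - d) * ((‖x‖ ^ ε + ‖x‖ ^ (-ε)) / ε) := by
            gcongr; exact Real.abs_log_le_rpow_add_rpow hx hε0
        _ = (‖x‖ ^ (z.re - d + ε) + ‖x‖ ^ (z.re - d + -ε)) / ε := by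
            rw [Real.rpow_add hx, Real.rpow_add hx]; ring
        _ ≤ ((‖x‖ ^ (σ / 2 - d) + ‖x‖ ^ (2 * σ - d)) +
              (‖x‖ ^ (σ / 2 - d) + ‖x‖ ^ (2 * σ - d))) / ε := by
            gcongr
            · exact Real.rpow_le_rpow_add_rpow hx (by linarith) (by linarith)
            · exact Real.rpow_le_rpow_add_rpow hx (by linarith) (by linarith)
        _ = _ := by ring
    calc _ ≤ 2 / ε * (‖x‖ ^ (σ / 2 - d) + ‖x‖ ^ (2 * σ - d)) * ‖h x‖ := by gcongr
      _ = bound x := by simp only [bound]; ring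
  · exact ((h.integrable_rpow_norm_mul_norm (by positivity)).add
      (h.integrable_rpow_norm_mul_norm (by positivity))).const_mul _
  · filter_upwards [ae_norm_pos V] with x hx z _
    have hx0 : (‖x‖ : ℂ) ≠ 0 := by exact_mod_cast hx.ne'
    have := ((hasDerivAt_id z).sub_const (finrank ℝ V : ℂ)).const_cpow (c := (‖x‖ : ℂ)) (Or.inl hx0)
    simp only [id, mul_one] at this
    rw [← Complex.ofReal_log hx.le] at this
    exact this.mul_const _

/-- `h ↦ ∫ |x| ^ (s - d) h(x) dx` as a tempered distribution, for `Re s > 0`. -/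
noncomputable def radialMomentCLM [Nontrivial V] (s : ℂ) (hs : 0 < s.re) : 𝓢(V, ℂ) →L[ℂ] ℂ :=
  SchwartzMap.mkCLMtoNormedSpace (fun h => radialMoment h s)
    (fun f g => by
      simp only [radialMoment, add_apply, mul_add]
      exact integral_add (f.integrable_cpow_norm_mul hs) (g.integrable_cpow_norm_mul hs))
    (fun a f => by
      simp only [radialMoment, smul_apply, smul_eq_mul, RingHom.id_apply]
      rw [← integral_const_mul]
      congr 1; ext x; ring)
    (by
      obtain ⟨k, hk⟩ := exists_nat_gt s.re
      obtain ⟨S, C, hC, hb⟩ := SchwartzMap.exists_norm_le_one_add_rpow (V := V) k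
      have hint := integrable_rpow_norm_mul_one_add_rpow (V := V) hs hk
      refine ⟨S, C * ∫ x : V, ‖x‖ ^ (s.re - finrank ℝ V) * (1 + ‖x‖) ^ (-(k : ℝ)),
        mul_nonneg hC (integral_nonneg fun x => by positivity), fun h => ?_⟩
      rw [mul_right_comm, ← integral_const_mul]
      refine norm_integral_le_of_norm_le (hint.const_mul _) ?_
      filter_upwards [ae_norm_pos V] with x hx
      rw [norm_cpow_norm_mul hx]
      calc _ ≤ ‖x‖ ^ (s.re - finrank ℝ V) *
          (C * S.sup (schwartzSeminormFamily ℂ V ℂ) h * (1 + ‖x‖) ^ (-(k : ℝ))) := by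
            gcongr; exact hb h x
        _ = _ := by ring)

end RadialMoment

/-! ### Fourier transform of the heat kernel, and the Laplacian on the Fourier side. -/

section HeatKernel

open scoped FourierTransform Laplacian

variable {V : Type*} [NormedAddCommGroup V] [InnerProductSpace ℝ V] [FiniteDimensional ℝ V]
  [MeasurableSpace V] [BorelSpace V]

variable (V) in
/-- The inclusion of the test functions into the Schwartz functions. -/
noncomputable def testFunToSchwartz : TestFun V →L[ℂ] 𝓢(V, ℂ) :=
  TestFunction.mkCLM ℂ (fun φ => φ.hasCompactSupport.toSchwartzMap φ.contDiff)
    (fun _ _ => rfl) (fun _ _ => rfl) (by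
      intro K hK
      let Φ : 𝓓^{⊤}_{K}(V, ℂ) →ₗ[ℂ] 𝓢(V, ℂ) :=
        { toFun := fun φ => φ.hasCompactSupport.toSchwartzMap φ.contDiff
          map_add' := fun _ _ => rfl
          map_smul' := fun _ _ => rfl }
      change Continuous Φ
      obtain ⟨R, hR⟩ := K.isCompact.isBounded.exists_norm_le
      refine WithSeminorms.continuous_of_isBounded (ContDiffMapSupportedIn.withSeminorms ℂ V ℂ ⊤ K)
        (schwartz_withSeminorms ℂ V ℂ) Φ (.of_real fun i => ?_)
      refine ⟨{i.2}, |R| ^ i.1, fun φ => ?_⟩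
      change SchwartzMap.seminorm ℂ i.1 i.2 (Φ φ) ≤
        |R| ^ i.1 * ({i.2} : Finset ℕ).sup (ContDiffMapSupportedIn.seminorm ℂ V ℂ ⊤ K) φ
      rw [Finset.sup_singleton]
      refine SchwartzMap.seminorm_le_bound ℂ _ _ _ (by positivity) fun x => ?_
      have h1 := ContDiffMapSupportedIn.norm_iteratedFDeriv_apply_le_seminorm_top ℂ (f := φ)
        (i := i.2) (x := x)
      change ‖x‖ ^ i.1 * ‖iteratedFDeriv ℝ i.2 φ x‖ ≤ _
      by_cases hx : x ∈ K
      · gcongr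
        exact (hR x hx).trans (le_abs_self R)
      · rw [φ.iteratedFDeriv_zero_on_compl hx]
        simp only [Pi.zero_apply, norm_zero, mul_zero]
        positivity)

@[simp]
theorem coe_testFunToSchwartz (φ : TestFun V) : ⇑(testFunToSchwartz V φ) = φ := rfl

/-- The positive Laplace operator on Schwartz functions. -/
noncomputable def negLaplacian (ψ : 𝓢(V, ℂ)) : 𝓢(V, ℂ) := -Δ ψ

theorem coe_negLaplacian (ψ : 𝓢(V, ℂ)) : ⇑(negLaplacian ψ) = posLaplacian ψ := by
  ext x
  simp only [negLaplacian, posLaplacian]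
  rw [← SchwartzMap.laplacian_apply]
  rfl

theorem coe_iterate_negLaplacian (k : ℕ) (ψ : 𝓢(V, ℂ)) :
    ⇑(negLaplacian^[k] ψ) = posLaplacian^[k] ψ := by
  induction k generalizing ψ with
  | zero => rfl
  | succ k ih => rw [Function.iterate_succ_apply, Function.iterate_succ_apply, ih, coe_negLaplacian]

/-- The Fourier transform `ξ ↦ (2π)^{-d} ∫ exp (i ⟨v, ξ⟩) ψ(v) dv`. -/
noncomputable def normFourier : 𝓢(V, ℂ) →L[ℂ] 𝓢(V, ℂ) :=
  (((2 * Real.pi : ℝ) : ℂ)⁻¹ ^ finrank ℝ V) •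
    -- The kernel of `𝓕` is `exp(-2πi⟨v, w⟩)`; substituting `w = -ξ/(2π)` turns it into `exp(i⟨v,
    -- ξ⟩)`.
    (SchwartzMap.compCLMOfContinuousLinearEquiv ℂ
      (ContinuousLinearEquiv.smulLeft (R₁ := ℝ) (M₁ := V)
        (Units.mk0 (-(2 * Real.pi)⁻¹ : ℝ) (by simp [Real.pi_ne_zero]))) ∘L
      SchwartzMap.fourierTransformCLM ℂ)

theorem normFourier_apply_eq (ψ : 𝓢(V, ℂ)) (ξ : V) : normFourier ψ ξ =
    ((2 * Real.pi : ℝ) : ℂ)⁻¹ ^ finrank ℝ V * 𝓕 ψ (-(2 * Real.pi)⁻¹ • ξ) := rfl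

theorem normFourier_apply (ψ : 𝓢(V, ℂ)) (ξ : V) : normFourier ψ ξ =
    ((2 * Real.pi : ℝ) : ℂ)⁻¹ ^ finrank ℝ V *
      ∫ v : V, Complex.exp (Complex.I * (inner ℝ v ξ : ℝ)) * ψ v := by
  rw [normFourier_apply_eq, SchwartzMap.fourier_coe, Real.fourier_eq']
  congr 2; ext v
  rw [smul_eq_mul]
  congr 2
  rw [inner_smul_right]
  have : (Real.pi : ℂ) ≠ 0 := by exact_mod_cast Real.pi_ne_zero
  push_cast
  field_simp

theorem normFourier_negLaplacian (ψ : 𝓢(V, ℂ)) (ξ : V) :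
    normFourier (negLaplacian ψ) ξ = (‖ξ‖ : ℂ) ^ 2 * normFourier ψ ξ := by
  have h1 : 𝓕 (negLaplacian ψ) (-(2 * Real.pi)⁻¹ • ξ) =
      (‖ξ‖ : ℂ) ^ 2 * 𝓕 ψ (-(2 * Real.pi)⁻¹ • ξ) := by
    have hpi : (Real.pi : ℂ) ≠ 0 := by exact_mod_cast Real.pi_ne_zero
    rw [negLaplacian, SchwartzMap.laplacian_eq_fourierMultiplierCLM,
      SchwartzMap.fourierMultiplierCLM_apply, FourierTransform.fourier_neg,
      FourierTransform.fourier_smul, FourierTransform.fourier_fourierInv_eq]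
    simp only [neg_apply, smul_apply]
    rw [SchwartzMap.smulLeftCLM_apply_apply (by fun_prop), norm_smul]
    simp only [Complex.real_smul, norm_neg, norm_inv, Real.norm_eq_abs,
      abs_of_pos Real.two_pi_pos]
    push_cast
    field_simp
  rw [normFourier_apply_eq, normFourier_apply_eq, h1]
  ring

theorem normFourier_iterate_negLaplacian (k : ℕ) (ψ : 𝓢(V, ℂ)) (ξ : V) :
    normFourier (negLaplacian^[k] ψ) ξ = (‖ξ‖ : ℂ) ^ (2 * k) * normFourier ψ ξ := by
  induction k with
  | zero => simp
  | succ k ih =>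
    rw [Function.iterate_succ_apply', normFourier_negLaplacian, ih]
    ring

/-- Each Laplacian becomes a factor `|ξ|²`. This is the Fourier form of `I_{α+2k}[Δ^k φ] = I_α[φ]`.
-/
theorem radialMoment_normFourier_iterate_negLaplacian [Nontrivial V] (k : ℕ) (ψ : 𝓢(V, ℂ))
    (s : ℂ) : radialMoment (normFourier (negLaplacian^[k] ψ)) s =
      radialMoment (normFourier ψ) (s + 2 * k) := by
  refine integral_congr_ae ?_
  filter_upwards [ae_norm_pos V] with x hx
  have hx0 : (‖x‖ : ℂ) ≠ 0 := by exact_mod_cast hx.ne'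
  rw [normFourier_iterate_negLaplacian, ← mul_assoc, ← Complex.cpow_natCast,
    ← Complex.cpow_add _ _ hx0]
  congr 2
  push_cast
  ring

theorem integrable_pow_norm_mul_exp_neg [Nontrivial V] {m : ℕ} (hm : 1 ≤ m) (j : ℕ) {t : ℝ}
    (ht : 0 < t) : Integrable fun ξ : V => ‖ξ‖ ^ j * Real.exp (-(t * ‖ξ‖ ^ (2 * m))) := by
  rw [integrable_fun_norm_addHaar (volume : Measure V)
    (f := fun y : ℝ => y ^ j * Real.exp (-(t * y ^ (2 * m))))]
  have key := integrableOn_rpow_mul_exp_neg_mul_rpow (p := ((2 * m : ℕ) : ℝ))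
    (s := ((finrank ℝ V - 1 + j : ℕ) : ℝ)) (b := t)
    (lt_of_lt_of_le (by norm_num) (Nat.cast_nonneg _)) (by positivity) ht
  refine key.congr_fun (fun y hy => ?_) measurableSet_Ioi
  simp only [smul_eq_mul]
  rw [Real.rpow_natCast, Real.rpow_natCast, pow_add, neg_mul, mul_assoc]

theorem integrable_exp_neg_mul_pow_norm [Nontrivial V] {m : ℕ} (hm : 1 ≤ m) {t : ℝ} (ht : 0 < t) :
    Integrable fun ξ : V => Real.exp (-(t * ‖ξ‖ ^ (2 * m))) := by
  simpa using integrable_pow_norm_mul_exp_neg (V := V) hm 0 ht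

/-- The pairing of a Schwartz function with `ξ ↦ exp (-t |ξ| ^ (2 m))`. -/
noncomputable def expPairing (m : ℕ) (h : V → ℂ) (t : ℝ) : ℂ :=
  ∫ ξ : V, ((Real.exp (-(t * ‖ξ‖ ^ (2 * m))) : ℝ) : ℂ) * h ξ

/-- The heat kernel is itself a Fourier integral, so Fubini moves the transform onto `ψ`; the
Gaussian-type factor makes the double integral absolutely convergent. -/
theorem integral_heatKernel_mul [Nontrivial V] {m : ℕ} (hm : 1 ≤ m) (ψ : 𝓢(V, ℂ)) {t : ℝ}
    (ht : 0 < t) : ∫ v, heatKernel m t v * ψ v = expPairing m (normFourier ψ) t := by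
  set c := ((2 * Real.pi : ℝ) : ℂ)⁻¹ ^ finrank ℝ V with hc
  set f : V → V → ℂ := fun v ξ =>
    Complex.exp (Complex.I * (inner ℝ v ξ : ℝ) - ((t * ‖ξ‖ ^ (2 * m) : ℝ) : ℂ)) * ψ v with hf
  have hint : Integrable (Function.uncurry f) (volume.prod volume) := by
    refine ((ψ.integrable (μ := volume)).norm.mul_prod
      (integrable_exp_neg_mul_pow_norm hm ht)).mono' ?_ ?_
    · have hψ : Continuous ψ := ψ.continuous
      refine Continuous.aestronglyMeasurable ?_
      simp only [hf, Function.uncurry_def]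
      fun_prop
    · refine ae_of_all _ fun p => ?_
      simp only [hf, Function.uncurry_def]
      rw [norm_mul, Complex.norm_exp, mul_comm, Complex.sub_re, Complex.ofReal_re]
      simp
  have h1 : ∀ v, heatKernel m t v * ψ v = c * ∫ ξ, f v ξ := fun v => by
    rw [heatKernel, integral_mul_const, mul_assoc]
  simp_rw [h1]
  rw [integral_const_mul, integral_integral_swap hint, expPairing, ← integral_const_mul]
  congr 1; ext ξ
  rw [normFourier_apply, mul_left_comm]
  congr 1
  rw [← integral_const_mul]
  refine integral_congr_ae (ae_of_all _ fun v => ?_)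
  simp only [hf]
  rw [Complex.ofReal_exp, ← mul_assoc, ← Complex.exp_add]
  congr 2
  push_cast
  ring

end HeatKernel

/-! ### Mellin transform in `t` of the heat pairing, over `(0, ∞)` and over `(0, 1]`. -/

section MellinPairing

open Set

variable {V : Type*} [NormedAddCommGroup V] [InnerProductSpace ℝ V] [FiniteDimensional ℝ V]
  [MeasurableSpace V] [BorelSpace V]

theorem norm_expPairing_integrand_le (m : ℕ) (h : V → ℂ) {t : ℝ} (ht : 0 ≤ t) (ξ : V) :
    ‖((Real.exp (-(t * ‖ξ‖ ^ (2 * m))) : ℝ) : ℂ) * h ξ‖ ≤ ‖h ξ‖ := by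
  rw [norm_mul, Complex.norm_real, Real.norm_of_nonneg (Real.exp_nonneg _)]
  refine mul_le_of_le_one_left (norm_nonneg _) (Real.exp_le_one_iff.2 ?_)
  have : 0 ≤ t * ‖ξ‖ ^ (2 * m) := by positivity
  linarith

theorem norm_expPairing_le (m : ℕ) (h : 𝓢(V, ℂ)) {t : ℝ} (ht : 0 ≤ t) :
    ‖expPairing m h t‖ ≤ ∫ ξ, ‖h ξ‖ :=
  norm_integral_le_of_norm_le (h.integrable (μ := volume)).norm
    (ae_of_all _ fun ξ => norm_expPairing_integrand_le m h ht ξ)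

theorem aestronglyMeasurable_expPairing_integrand (m : ℕ) (h : 𝓢(V, ℂ)) (t : ℝ) :
    AEStronglyMeasurable (fun ξ => ((Real.exp (-(t * ‖ξ‖ ^ (2 * m))) : ℝ) : ℂ) * h ξ) := by
  have := h.continuous
  exact Continuous.aestronglyMeasurable (by fun_prop)

theorem integrable_expPairing_integrand (m : ℕ) (h : 𝓢(V, ℂ)) {t : ℝ} (ht : 0 ≤ t) :
    Integrable (fun ξ => ((Real.exp (-(t * ‖ξ‖ ^ (2 * m))) : ℝ) : ℂ) * h ξ) :=
  (h.integrable (μ := volume)).norm.mono' (aestronglyMeasurable_expPairing_integrand m h t)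
    (ae_of_all _ fun ξ => norm_expPairing_integrand_le m h ht ξ)

theorem continuousOn_expPairing (m : ℕ) (h : 𝓢(V, ℂ)) :
    ContinuousOn (expPairing m h) (Ici 0) := by
  refine continuousOn_of_dominated (bound := fun ξ => ‖h ξ‖)
    (fun t _ => aestronglyMeasurable_expPairing_integrand m h t)
    (fun t ht => ae_of_all _ fun ξ => norm_expPairing_integrand_le m h ht ξ)
    (h.integrable (μ := volume)).norm (ae_of_all _ fun ξ => ?_)
  exact Continuous.continuousOn (by fun_prop)

theorem integral_Ioi_integral_swap {f : ℝ → V → ℂ}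
    (hf : AEStronglyMeasurable (Function.uncurry f) ((volume.restrict (Ioi 0)).prod volume))
    (h1 : ∀ᵐ x, IntegrableOn (fun t => f t x) (Ioi 0))
    (h2 : Integrable fun x => ∫ t in Ioi 0, ‖f t x‖) :
    IntegrableOn (fun t => ∫ x, f t x) (Ioi 0) ∧
      ∫ t in Ioi 0, ∫ x, f t x = ∫ x, ∫ t in Ioi 0, f t x := by
  have H : Integrable (Function.uncurry f) ((volume.restrict (Ioi 0)).prod volume) :=
    (integrable_prod_iff' hf).2 ⟨h1, h2⟩
  exact ⟨H.integral_prod_left, integral_integral_swap H⟩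

theorem integrableOn_rpow_mul_exp_neg_mul {a r : ℝ} (ha : 0 < a) (hr : 0 < r) :
    IntegrableOn (fun t : ℝ => t ^ (a - 1) * Real.exp (-(r * t))) (Ioi 0) := by
  have := Real.Gamma_pos_of_pos ha
  -- A non-integrable function has integral `0` by convention, so the nonzero Gamma value forces
  -- integrability.
  exact .of_integral_ne_zero (by rw [Real.integral_rpow_mul_exp_neg_mul_Ioi ha hr]; positivity)

theorem Complex.one_div_ofReal_pow_cpow {r : ℝ} (hr : 0 < r) (k : ℕ) (α : ℂ) :
    (1 / ((r ^ k : ℝ) : ℂ)) ^ α = (r : ℂ) ^ (-(k * α)) := by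
  have hr0 : (r : ℂ) ≠ 0 := by exact_mod_cast hr.ne'
  rw [← Complex.ofReal_one, ← Complex.ofReal_div, Complex.cpow_def_of_ne_zero
    (by exact_mod_cast (by positivity : (1 / r ^ k : ℝ) ≠ 0)), Complex.cpow_def_of_ne_zero hr0,
    ← Complex.ofReal_log (by positivity), ← Complex.ofReal_log hr.le, one_div, Real.log_inv,
    Real.log_pow]
  congr 1
  push_cast
  ring

/-- After Fubini the inner integral is `∫ t^(α-1) exp(-t|ξ|^(2m)) dt = Γ(α) |ξ|^(-2mα)`. The upper
bound on `Re α` makes this power integrable at the origin. -/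
theorem hasMellin_expPairing [Nontrivial V] (m : ℕ) (h : 𝓢(V, ℂ)) {α : ℂ}
    (hα : 0 < α.re) (hα' : 2 * m * α.re < finrank ℝ V) :
    HasMellin (expPairing m h) α
      (Complex.Gamma α * radialMoment h (finrank ℝ V - 2 * m * α)) := by
  set f : ℝ → V → ℂ := fun t ξ =>
    (t : ℂ) ^ (α - 1) * (((Real.exp (-(t * ‖ξ‖ ^ (2 * m))) : ℝ) : ℂ) * h ξ) with hf
  have hre : ((finrank ℝ V : ℂ) - 2 * m * α).re = finrank ℝ V - 2 * m * α.re := by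
    have : (2 * m * α : ℂ) = ((2 * m : ℝ) : ℂ) * α := by push_cast; ring
    rw [this, Complex.sub_re, Complex.re_ofReal_mul]
    simp
  have hs : 0 < ((finrank ℝ V : ℂ) - 2 * m * α).re := by rw [hre]; linarith
  have hmeas : AEStronglyMeasurable (Function.uncurry f)
      ((volume.restrict (Ioi 0)).prod volume) := by
    refine Measurable.aestronglyMeasurable ?_
    have := h.continuous
    simp only [hf, Function.uncurry_def]
    refine Measurable.mul ((Complex.measurable_ofReal.comp measurable_fst).pow_const _) ?_
    exact Continuous.measurable (by fun_prop)
  have hnorm : ∀ {t : ℝ}, 0 < t → ∀ ξ, ‖f t ξ‖ =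
      t ^ (α.re - 1) * Real.exp (-(‖ξ‖ ^ (2 * m) * t)) * ‖h ξ‖ := fun {t} ht ξ => by
    simp only [hf]
    rw [norm_mul, norm_mul, Complex.norm_cpow_eq_rpow_re_of_pos ht, Complex.norm_real,
      Real.norm_of_nonneg (Real.exp_nonneg _), mul_comm t]
    simp [mul_assoc]
  have key := integral_Ioi_integral_swap hmeas ?_ ?_
  · have e1 : ∀ t : ℝ, ∫ ξ, f t ξ = (t : ℂ) ^ (α - 1) • expPairing m h t := fun t => by
      simp only [hf]
      rw [integral_const_mul, smul_eq_mul, expPairing]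
    simp only [e1] at key
    refine ⟨key.1, ?_⟩
    rw [mellin, key.2, radialMoment, ← integral_const_mul]
    refine integral_congr_ae ?_
    filter_upwards [ae_norm_pos V] with ξ hξ
    have hr : 0 < ‖ξ‖ ^ (2 * m) := by positivity
    have := Complex.integral_cpow_mul_exp_neg_mul_Ioi hα hr
    have e2 : ∀ t : ℝ, f t ξ =
        (t : ℂ) ^ (α - 1) * Complex.exp (-(((‖ξ‖ ^ (2 * m) : ℝ) : ℂ) * t)) * h ξ := fun t => by
      simp only [hf]
      rw [← mul_assoc, Complex.ofReal_exp]
      congr 3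
      push_cast
      ring
    simp only [e2]
    rw [integral_mul_const, this, Complex.one_div_ofReal_pow_cpow hξ]
    rw [show (finrank ℝ V : ℂ) - 2 * m * α - finrank ℝ V = -(((2 * m : ℕ) : ℂ) * α) by
      push_cast; ring]
    ring
  · filter_upwards [ae_norm_pos V] with ξ hξ
    have hr : 0 < ‖ξ‖ ^ (2 * m) := by positivity
    refine Integrable.mono' ((integrableOn_rpow_mul_exp_neg_mul hα hr).mul_const ‖h ξ‖) ?_ ?_
    · refine Measurable.aestronglyMeasurable ?_
      simp only [hf]
      refine Measurable.mul (Complex.measurable_ofReal.pow_const _) ?_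
      exact Continuous.measurable (by fun_prop)
    · filter_upwards [ae_restrict_mem measurableSet_Ioi] with t ht using (hnorm ht ξ).le
  · have : Integrable fun ξ : V => Real.Gamma α.re *
        (‖ξ‖ ^ (finrank ℝ V - 2 * m * α.re - finrank ℝ V : ℝ) * ‖h ξ‖) :=
      (h.integrable_rpow_norm_mul_norm (by linarith)).const_mul _
    refine this.congr ?_
    filter_upwards [ae_norm_pos V] with ξ hξ
    have hr : 0 < ‖ξ‖ ^ (2 * m) := by positivity
    rw [setIntegral_congr_fun measurableSet_Ioi (fun t ht => hnorm ht ξ), integral_mul_const,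
      Real.integral_rpow_mul_exp_neg_mul_Ioi hα hr, one_div, ← Real.rpow_natCast,
      ← Real.rpow_neg hξ.le, ← Real.rpow_mul hξ.le]
    have : (finrank ℝ V - 2 * m * α.re - finrank ℝ V : ℝ) = -((2 * m : ℕ) : ℝ) * α.re := by
      push_cast; ring
    rw [this]
    ring

theorem intervalIntegrable_expPairing_mul_cpow (m : ℕ) (h : 𝓢(V, ℂ)) {α : ℂ} (hα : 0 < α.re) :
    IntegrableOn (fun t : ℝ => (t : ℂ) ^ (α - 1) * expPairing m h t) (Ioc 0 1) := by
  have h1 : IntegrableOn (fun t : ℝ => t ^ (α.re - 1) * ∫ ξ, ‖h ξ‖) (Ioc 0 1) := by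
    refine Integrable.mul_const ?_ _
    exact (intervalIntegrable_iff_integrableOn_Ioc_of_le zero_le_one).1
      (intervalIntegral.intervalIntegrable_rpow' (by linarith))
  refine Integrable.mono' h1 ?_ ?_
  · refine AEStronglyMeasurable.mul ?_ ?_
    · exact (Complex.measurable_ofReal.pow_const _).aestronglyMeasurable
    · exact ((continuousOn_expPairing m h).mono fun t ht => ht.1.le).aestronglyMeasurable
        measurableSet_Ioc
  · filter_upwards [ae_restrict_mem measurableSet_Ioc] with t ht
    rw [norm_mul, Complex.norm_cpow_eq_rpow_re_of_pos ht.1, Complex.sub_re, Complex.one_re]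
    have := norm_expPairing_le m h ht.1.le
    have := ht.1
    gcongr

theorem intervalIntegrable_heatIntegrand [Nontrivial V] {m : ℕ} (hm : 1 ≤ m) (ψ : 𝓢(V, ℂ)) {α : ℂ}
    (hα : 0 < α.re) : IntervalIntegrable (heatIntegrand m α ψ) volume 0 1 := by
  rw [intervalIntegrable_iff_integrableOn_Ioc_of_le zero_le_one]
  refine (intervalIntegrable_expPairing_mul_cpow m (normFourier ψ) hα).congr_fun
    (fun t ht => ?_) measurableSet_Ioc
  simp only [heatIntegrand]
  rw [integral_heatKernel_mul hm ψ ht.1, mul_comm]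

theorem heatMellin_eq_integral [Nontrivial V] {m : ℕ} (hm : 1 ≤ m) (ψ : 𝓢(V, ℂ)) (α : ℂ) :
    heatMellin m α ψ = (Complex.Gamma α)⁻¹ *
      ∫ t in Ioc (0 : ℝ) 1, (t : ℂ) ^ (α - 1) * expPairing m (normFourier ψ) t := by
  rw [heatMellin, intervalIntegral.integral_of_le zero_le_one]
  congr 1
  refine setIntegral_congr_fun measurableSet_Ioc fun t ht => ?_
  simp only [heatIntegrand]
  rw [integral_heatKernel_mul hm ψ ht.1, mul_comm]

/-- Cutting the pairing off at `t = 1` gives a Mellin transform of a function bounded near `0` and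
zero near infinity, hence holomorphic for `Re α > 0`; the factor `1/Γ` is entire. -/
theorem differentiableAt_heatMellin [Nontrivial V] {m : ℕ} (hm : 1 ≤ m) (ψ : 𝓢(V, ℂ)) {α : ℂ}
    (hα : 0 < α.re) : DifferentiableAt ℂ (fun β => heatMellin m β ψ) α := by
  set F : ℝ → ℂ := (Ioc 0 1).indicator (expPairing m (normFourier ψ)) with hF
  have e1 : (fun β => heatMellin m β ψ) = fun β => (Complex.Gamma β)⁻¹ * mellin F β := by
    ext β
    rw [heatMellin_eq_integral hm, mellin]
    congr 1
    have : ∀ t : ℝ, (t : ℂ) ^ (β - 1) • F t = (Ioc (0 : ℝ) 1).indicator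
        (fun t : ℝ => (t : ℂ) ^ (β - 1) * expPairing m (normFourier ψ) t) t := fun t => by
      by_cases ht : t ∈ Ioc (0 : ℝ) 1 <;> simp [hF, ht]
    simp only [this]
    rw [setIntegral_indicator measurableSet_Ioc]
    congr 2
    ext t
    simp only [mem_Ioc, mem_inter_iff, mem_Ioi]
    tauto
  rw [e1]
  refine Complex.differentiable_one_div_Gamma.differentiableAt.mul ?_
  have hFi : Integrable F := by
    rw [hF, integrable_indicator_iff measurableSet_Ioc]
    exact (((continuousOn_expPairing m (normFourier ψ)).mono
      fun t ht => ht.1).integrableOn_compact isCompact_Icc).mono_set Ioc_subset_Icc_self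
  refine mellin_differentiableAt_of_isBigO_rpow (a := α.re + 1) (b := 0)
    (hFi.locallyIntegrable.locallyIntegrableOn _) ?_ (by linarith) ?_ hα
  · refine Asymptotics.IsBigO.of_bound 1 ?_
    filter_upwards [eventually_gt_atTop 1] with t ht
    have : t ∉ Ioc (0 : ℝ) 1 := fun h => ht.not_ge h.2
    simp only [hF, this, not_false_eq_true, indicator_of_notMem, norm_zero]
    positivity
  · refine Asymptotics.IsBigO.of_bound (∫ ξ, ‖normFourier ψ ξ‖) ?_
    filter_upwards [self_mem_nhdsWithin] with t ht
    rw [neg_zero, Real.rpow_zero, norm_one, mul_one]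
    exact (norm_indicator_le_norm_self _ _).trans (norm_expPairing_le m _ (le_of_lt ht))

theorem exists_integral_norm_le [Nontrivial V] : ∃ (s : Finset (ℕ × ℕ)) (C : ℝ), 0 ≤ C ∧
    ∀ h : 𝓢(V, ℂ), ∫ x, ‖h x‖ ≤ C * s.sup (schwartzSeminormFamily ℂ V ℂ) h := by
  have hd : (0 : ℝ) < finrank ℝ V := by exact_mod_cast finrank_pos
  obtain ⟨k, hk⟩ := exists_nat_gt (finrank ℝ V : ℝ)
  obtain ⟨S, C, hC, hb⟩ := SchwartzMap.exists_norm_le_one_add_rpow (V := V) k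
  -- With `σ` equal to the dimension the weight `‖x‖ ^ (σ - d)` is `1`.
  have hint := integrable_rpow_norm_mul_one_add_rpow (V := V) hd hk
  simp only [sub_self, Real.rpow_zero, one_mul] at hint
  refine ⟨S, C * ∫ x : V, (1 + ‖x‖) ^ (-(k : ℝ)),
    mul_nonneg hC (integral_nonneg fun x => by positivity), fun h => ?_⟩
  rw [mul_right_comm, ← integral_const_mul]
  exact integral_mono (h.integrable (μ := volume)).norm (hint.const_mul _) (hb h)

/-- The tempered distribution `h ↦ ∫_0^1 t ^ (α - 1) ∫ exp (-t |ξ| ^ (2 m)) h(ξ) dξ dt`. -/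
noncomputable def truncatedMellinCLM [Nontrivial V] (m : ℕ) (α : ℂ) (hα : 0 < α.re) :
    𝓢(V, ℂ) →L[ℂ] ℂ :=
  SchwartzMap.mkCLMtoNormedSpace
    (fun h => ∫ t in Ioc (0 : ℝ) 1, (t : ℂ) ^ (α - 1) * expPairing m h t)
    (fun f g => by
      rw [← integral_add (intervalIntegrable_expPairing_mul_cpow m f hα)
        (intervalIntegrable_expPairing_mul_cpow m g hα)]
      refine setIntegral_congr_fun measurableSet_Ioc fun t ht => ?_
      simp only [expPairing, add_apply, mul_add]
      rw [integral_add (integrable_expPairing_integrand m f ht.1.le)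
        (integrable_expPairing_integrand m g ht.1.le), mul_add])
    (fun a f => by
      rw [RingHom.id_apply, smul_eq_mul, ← integral_const_mul]
      refine setIntegral_congr_fun measurableSet_Ioc fun t ht => ?_
      simp only [expPairing, smul_apply, smul_eq_mul]
      rw [mul_left_comm]
      congr 1
      rw [← integral_const_mul]
      refine integral_congr_ae (ae_of_all _ fun ξ => ?_)
      simp only
      ring)
    (by
      obtain ⟨S, C, hC, hb⟩ := exists_integral_norm_le (V := V)
      have hint : IntegrableOn (fun t : ℝ => t ^ (α.re - 1)) (Ioc 0 1) :=
        (intervalIntegrable_iff_integrableOn_Ioc_of_le zero_le_one).1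
          (intervalIntegral.intervalIntegrable_rpow' (by linarith))
      refine ⟨S, (∫ t in Ioc (0 : ℝ) 1, t ^ (α.re - 1)) * C, mul_nonneg
        (setIntegral_nonneg measurableSet_Ioc fun t ht => Real.rpow_nonneg ht.1.le _) hC,
        fun h => ?_⟩
      rw [mul_assoc, ← integral_mul_const]
      refine norm_integral_le_of_norm_le (hint.mul_const _) ?_
      filter_upwards [ae_restrict_mem measurableSet_Ioc] with t ht
      rw [norm_mul, Complex.norm_cpow_eq_rpow_re_of_pos ht.1, Complex.sub_re, Complex.one_re]
      have := (norm_expPairing_le m h ht.1.le).trans (hb h)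
      have := ht.1
      gcongr)

/-- The distribution `E_{m,α}` for `Re α > 0`. -/
noncomputable def heatMellinCLM [Nontrivial V] (m : ℕ) (α : ℂ) (hα : 0 < α.re) : Distr V :=
  (Complex.Gamma α)⁻¹ • (truncatedMellinCLM m α hα ∘L normFourier ∘L testFunToSchwartz V)

theorem heatMellinCLM_apply [Nontrivial V] {m : ℕ} (hm : 1 ≤ m) {α : ℂ} (hα : 0 < α.re)
    (φ : TestFun V) : heatMellinCLM m α hα φ = heatMellin m α φ :=
  (heatMellin_eq_integral hm (testFunToSchwartz V φ) α).symm

end MellinPairing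

/-! ### The Fourier transform of the Riesz potential, from the Gaussian case `m = 1`. -/

section Riesz

open Set

variable {V : Type*} [NormedAddCommGroup V] [InnerProductSpace ℝ V] [FiniteDimensional ℝ V]
  [MeasurableSpace V] [BorelSpace V]

/-- The substitution `t ↦ 1/t` reduces this to the Gamma integral. -/
theorem Complex.integral_cpow_mul_exp_neg_div_Ioi {a : ℂ} {c : ℝ} (ha : 0 < a.re) (hc : 0 < c) :
    ∫ t in Ioi (0 : ℝ), (t : ℂ) ^ (-a - 1) * ((Real.exp (-(c / t)) : ℝ) : ℂ) =
      (1 / (c : ℂ)) ^ a * Complex.Gamma a := by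
  have h1 := mellin_comp_inv (fun t : ℝ => Complex.exp (-(c * t))) (-a)
  rw [neg_neg, mellin, mellin] at h1
  simp only [smul_eq_mul] at h1
  rw [Complex.integral_cpow_mul_exp_neg_mul_Ioi ha hc] at h1
  rw [← h1]
  congr 1; ext t
  push_cast
  rw [div_eq_mul_inv]

theorem Real.integral_rpow_mul_exp_neg_div_Ioi {a c : ℝ} (ha : 0 < a) (hc : 0 < c) :
    ∫ t in Ioi (0 : ℝ), t ^ (-a - 1) * Real.exp (-(c / t)) = (1 / c) ^ a * Real.Gamma a := by
  have := Complex.integral_cpow_mul_exp_neg_div_Ioi (a := a) (by simpa using ha) hc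
  rw [← Complex.ofReal_inj, ← integral_complex_ofReal, Complex.ofReal_mul,
    Complex.ofReal_cpow (by positivity), ← Complex.Gamma_ofReal, Complex.ofReal_div,
    Complex.ofReal_one, ← this]
  refine setIntegral_congr_fun measurableSet_Ioi fun t ht => ?_
  have ht : 0 < t := ht
  rw [Complex.ofReal_mul, Complex.ofReal_cpow ht.le]
  push_cast
  rfl

theorem integrableOn_rpow_mul_exp_neg_div {a c : ℝ} (ha : 0 < a) (hc : 0 < c) :
    IntegrableOn (fun t : ℝ => t ^ (-a - 1) * Real.exp (-(c / t))) (Ioi 0) := by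
  have := Real.Gamma_pos_of_pos ha
  exact .of_integral_ne_zero (by rw [Real.integral_rpow_mul_exp_neg_div_Ioi ha hc]; positivity)

theorem heatKernel_one {t : ℝ} (ht : 0 < t) (v : V) : heatKernel 1 t v =
    ((2 * Real.pi : ℝ) : ℂ)⁻¹ ^ finrank ℝ V * (Real.pi : ℂ) ^ ((finrank ℝ V : ℂ) / 2) *
      ((t : ℂ) ^ (-(finrank ℝ V : ℂ) / 2) * ((Real.exp (-(‖v‖ ^ 2 / 4 / t)) : ℝ) : ℂ)) := by
  have h1 := GaussianFourier.integral_cexp_neg_mul_sq_norm_add (V := V) (b := (t : ℂ))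
    (by simpa using ht) Complex.I v
  have h2 : (Real.pi / (t : ℂ)) ^ ((finrank ℝ V : ℂ) / 2) =
      (Real.pi : ℂ) ^ ((finrank ℝ V : ℂ) / 2) * (t : ℂ) ^ (-(finrank ℝ V : ℂ) / 2) := by
    rw [neg_div, Complex.cpow_neg, ← div_eq_mul_inv,
      Complex.div_cpow_ofReal_nonneg Real.pi_pos.le ht.le]
  rw [heatKernel, mul_assoc]
  congr 1
  rw [← mul_assoc, ← h2]
  convert! h1 using 2
  · ext ξ
    congr 1
    push_cast
    ring
  · rw [Complex.ofReal_exp, Complex.I_sq]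
    congr 1
    push_cast
    ring

/-- The Fourier transform of the Riesz potential. -/
theorem rieszConst_mul_radialMoment [Nontrivial V] (ψ : 𝓢(V, ℂ)) {w : ℂ} (hw : 0 < w.re)
    (hw' : w.re < finrank ℝ V) : rieszConst (finrank ℝ V) w * radialMoment ψ w =
      radialMoment (normFourier ψ) (finrank ℝ V - w) := by
  set a : ℂ := (finrank ℝ V - w) / 2 with ha
  have hare : a.re = (finrank ℝ V - w.re) / 2 := by
    rw [ha, Complex.div_ofNat_re, Complex.sub_re, Complex.natCast_re]
  have ha0 : 0 < a.re := by rw [hare]; linarith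
  set c0 : ℂ := ((2 * Real.pi : ℝ) : ℂ)⁻¹ ^ finrank ℝ V * (Real.pi : ℂ) ^ ((finrank ℝ V : ℂ) / 2)
    with hc0
  clear_value c0
  -- The Mellin transform of `t ↦ (e_t^1, ψ)` at `w/2` is computed twice. On the Fourier side it is
  -- `Γ(w/2)` times the moment of `normFourier ψ`; with the explicit Gaussian `f` it is a constant
  -- times `Γ((d-w)/2)` times the moment of `ψ`.
  have hmel := hasMellin_expPairing 1 (normFourier ψ) (α := w / 2)
    (by rw [Complex.div_ofNat_re]; linarith)
    (by rw [Complex.div_ofNat_re]; push_cast; linarith)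
  set f : ℝ → V → ℂ := fun t v =>
    c0 * ((t : ℂ) ^ (-a - 1) * ((Real.exp (-(‖v‖ ^ 2 / 4 / t)) : ℝ) : ℂ)) * ψ v with hf
  have e1 : mellin (expPairing 1 (normFourier ψ)) (w / 2) = ∫ t in Ioi (0 : ℝ), ∫ v, f t v := by
    rw [mellin]
    refine setIntegral_congr_fun measurableSet_Ioi fun t ht => ?_
    have ht : 0 < t := ht
    have ht0 : (t : ℂ) ≠ 0 := by exact_mod_cast ht.ne'
    rw [← integral_heatKernel_mul le_rfl ψ ht, smul_eq_mul, ← integral_const_mul]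
    refine integral_congr_ae (ae_of_all _ fun v => ?_)
    simp only [hf]
    rw [heatKernel_one ht, show -a - 1 = (w / 2 - 1) + (-(finrank ℝ V : ℂ) / 2) by rw [ha]; ring,
      Complex.cpow_add _ _ ht0, hc0]
    ring
  have hnorm : ∀ {t : ℝ}, 0 < t → ∀ v, ‖f t v‖ =
      ‖c0‖ * (t ^ (-a.re - 1) * Real.exp (-(‖v‖ ^ 2 / 4 / t))) * ‖ψ v‖ := fun {t} ht v => by
    simp only [hf]
    rw [norm_mul, norm_mul, norm_mul, Complex.norm_cpow_eq_rpow_re_of_pos ht, Complex.norm_real,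
      Real.norm_of_nonneg (Real.exp_nonneg _)]
    simp
  have hψ := ψ.continuous
  have hmeas : Measurable (Function.uncurry f) := by
    simp only [hf, Function.uncurry_def]
    refine Measurable.mul (Measurable.const_mul (Measurable.mul
      ((Complex.measurable_ofReal.comp measurable_fst).pow_const _) ?_) _)
      (hψ.measurable.comp measurable_snd)
    refine Complex.measurable_ofReal.comp (Real.measurable_exp.comp (Measurable.neg ?_))
    exact (((measurable_norm.comp measurable_snd).pow_const 2).div_const 4).div measurable_fst
  have hpow : ∀ v : V, 0 < ‖v‖ → (1 / ((‖v‖ ^ 2 / 4 : ℝ) : ℂ)) ^ a =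
      (4 : ℂ) ^ a * (‖v‖ : ℂ) ^ (w - finrank ℝ V) := fun v hv => by
    have h4 : (1 / ((‖v‖ ^ 2 / 4 : ℝ) : ℂ)) = (4 : ℝ) * ((1 / ‖v‖ ^ 2 : ℝ) : ℂ) := by
      push_cast; field_simp
    rw [h4, Complex.mul_cpow_ofReal_nonneg (by norm_num) (by positivity), Complex.ofReal_div,
      Complex.ofReal_one, Complex.one_div_ofReal_pow_cpow hv,
      show -(((2 : ℕ) : ℂ) * a) = w - finrank ℝ V by rw [ha]; push_cast; ring]
    push_cast
    rfl
  have key := integral_Ioi_integral_swap hmeas.aestronglyMeasurable ?_ ?_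
  · have hG : Complex.Gamma (w / 2) ≠ 0 :=
      Complex.Gamma_ne_zero_of_re_pos (by rw [Complex.div_ofNat_re]; linarith)
    have e2 : ∫ v, ∫ t in Ioi (0 : ℝ), f t v =
        c0 * (4 : ℂ) ^ a * Complex.Gamma a * radialMoment ψ w := by
      rw [radialMoment, ← integral_const_mul]
      refine integral_congr_ae ?_
      filter_upwards [ae_norm_pos V] with v hv
      simp only [hf]
      rw [integral_mul_const, integral_const_mul,
        Complex.integral_cpow_mul_exp_neg_div_Ioi ha0 (by positivity), hpow v hv]
      ring
    have e3 := hmel.2.symm.trans (e1.trans (key.2.trans e2))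
    rw [show (finrank ℝ V : ℂ) - 2 * (1 : ℕ) * (w / 2) = finrank ℝ V - w by push_cast; ring] at e3
    have h2pi : ((2 * Real.pi : ℝ) : ℂ) ≠ 0 := by exact_mod_cast Real.two_pi_pos.ne'
    have hc : c0 * (4 : ℂ) ^ a = ((2 : ℂ) ^ w * (Real.pi : ℂ) ^ ((finrank ℝ V : ℂ) / 2))⁻¹ := by
      have hpi : (Real.pi : ℂ) ≠ 0 := by exact_mod_cast Real.pi_ne_zero
      have h4 : (4 : ℂ) ^ a = (2 : ℂ) ^ (finrank ℝ V : ℂ) / (2 : ℂ) ^ w := by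
        rw [← Complex.cpow_sub _ _ two_ne_zero, show (4 : ℂ) = 2 * 2 by norm_num]
        have := Complex.mul_cpow_ofReal_nonneg (a := 2) (b := 2) (by norm_num) (by norm_num) a
        push_cast at this
        rw [this, ← Complex.cpow_add _ _ two_ne_zero, ha]
        congr 1; ring
      have hp : (Real.pi : ℂ) ^ finrank ℝ V = (Real.pi : ℂ) ^ ((finrank ℝ V : ℂ) / 2) *
          (Real.pi : ℂ) ^ ((finrank ℝ V : ℂ) / 2) := by
        rw [← Complex.cpow_add _ _ hpi, add_halves, Complex.cpow_natCast]
      have hp0 : (Real.pi : ℂ) ^ ((finrank ℝ V : ℂ) / 2) ≠ 0 := by simp [Complex.cpow_eq_zero_iff, hpi]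
      have hw0 : (2 : ℂ) ^ w ≠ 0 := by simp [Complex.cpow_eq_zero_iff]
      rw [hc0, h4, Complex.cpow_natCast, Complex.ofReal_mul, inv_pow, mul_pow, hp]
      push_cast
      field_simp
    rw [rieszConst, ← ha, div_eq_mul_inv, mul_inv, ← hc]
    calc _ = (Complex.Gamma (w / 2))⁻¹ *
          (c0 * (4 : ℂ) ^ a * Complex.Gamma a * radialMoment ψ w) := by ring
      _ = _ := by rw [← e3]; field_simp
  · filter_upwards [ae_norm_pos V] with v hv
    refine Integrable.mono' (((integrableOn_rpow_mul_exp_neg_div ha0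
      (by positivity : 0 < ‖v‖ ^ 2 / 4)).const_mul ‖c0‖).mul_const ‖ψ v‖)
      (hmeas.comp (measurable_id.prodMk measurable_const)).aestronglyMeasurable ?_
    filter_upwards [ae_restrict_mem measurableSet_Ioi] with t ht using (hnorm ht v).le
  · have : Integrable fun v : V => ‖c0 * (4 : ℂ) ^ a‖ * Real.Gamma a.re *
        (‖v‖ ^ (w.re - finrank ℝ V : ℝ) * ‖ψ v‖) :=
      (ψ.integrable_rpow_norm_mul_norm hw).const_mul _
    refine this.congr ?_
    filter_upwards [ae_norm_pos V] with v hv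
    have hr : 0 < ‖v‖ ^ 2 / 4 := by positivity
    have h5 : (1 / (‖v‖ ^ 2 / 4)) ^ a.re = ‖(4 : ℂ) ^ a‖ * ‖v‖ ^ (w.re - finrank ℝ V : ℝ) := by
      have := congrArg norm (hpow v hv)
      rw [norm_mul, Complex.norm_cpow_eq_rpow_re_of_pos hv, ← Complex.ofReal_one,
        ← Complex.ofReal_div, Complex.norm_cpow_eq_rpow_re_of_pos (by positivity)] at this
      simpa using this
    rw [setIntegral_congr_fun measurableSet_Ioi (fun t ht => hnorm ht v), integral_mul_const,
      integral_const_mul, Real.integral_rpow_mul_exp_neg_div_Ioi ha0 hr, h5, norm_mul]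
    ring

end Riesz

/-! ### Smooth functions `f(|v|²)` with `f` entire, and functionals bounded on them. -/

section RadialSmooth

open Set

variable {V : Type*} [NormedAddCommGroup V] [InnerProductSpace ℝ V] [FiniteDimensional ℝ V]

theorem iteratedDeriv_comp_ofReal {f : ℂ → ℂ} (hf : Differentiable ℂ f) (i : ℕ) :
    iteratedDeriv i (fun x : ℝ => f x) = fun x : ℝ => iteratedDeriv i f x := by
  induction i with
  | zero => simp
  | succ i ih =>
    ext x
    rw [iteratedDeriv_succ, ih, iteratedDeriv_succ]
    have h1 : DifferentiableAt ℂ (iteratedDeriv i f) x :=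
      (hf.contDiff (n := ⊤)).differentiable_iteratedDeriv i (by exact_mod_cast WithTop.coe_lt_top _) x
    exact h1.hasDerivAt.comp_ofReal.deriv

/-- The smooth function `v ↦ f (|v| ^ 2)` for an entire function `f`. -/
def radialSmooth (V : Type*) [NormedAddCommGroup V] [InnerProductSpace ℝ V] (f : ℂ → ℂ)
    (hf : Differentiable ℂ f) : SmoothFun V :=
  ⟨fun v => f ((‖v‖ ^ 2 : ℝ) : ℂ), ContDiff.comp (n := ∞) (g := f)
    (f := fun v : V => ((‖v‖ ^ 2 : ℝ) : ℂ)) (hf.contDiff.restrict_scalars ℝ)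
    (Complex.ofRealCLM.contDiff.comp (contDiff_norm_sq ℝ))⟩

/-- Cauchy's estimate on unit circles bounds the derivatives of `f` by its maximum on a disk (whence
the radius `r² + 1`), and the bound for derivatives of a composition does the rest. -/
theorem norm_iteratedFDeriv_radialSmooth_le {K : Set V} (hK : IsCompact K) (j : ℕ) :
    ∃ C R : ℝ, 0 ≤ C ∧ ∀ (f : ℂ → ℂ) (hf : Differentiable ℂ f) (M : ℝ),
      (∀ z, ‖z‖ ≤ R → ‖f z‖ ≤ M) → ∀ v ∈ K,
        ‖iteratedFDeriv ℝ j (radialSmooth V f hf) v‖ ≤ C * M := by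
  obtain ⟨r, hr⟩ := hK.isBounded.exists_norm_le
  have hq : ContDiff ℝ ∞ fun v : V => ‖v‖ ^ 2 := contDiff_norm_sq ℝ
  have hD : ∀ i : ℕ, ∃ D : ℝ, 0 ≤ D ∧
      ∀ v ∈ K, ‖iteratedFDeriv ℝ i (fun v : V => ‖v‖ ^ 2) v‖ ≤ D := fun i => by
    obtain ⟨D, hD⟩ := hK.exists_bound_of_continuousOn
      (hq.continuous_iteratedFDeriv (m := i) (by exact_mod_cast le_top)).continuousOn
    exact ⟨|D|, abs_nonneg D, fun v hv => (hD v hv).trans (le_abs_self D)⟩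
  choose D hD0 hD using hD
  -- The composition bound wants the `i`-th derivative of the inner function below `E ^ i`; as `E ≥
  -- 1` dominates every `D i`, this holds for `i ≥ 1`.
  set E : ℝ := 1 + ∑ i ∈ Finset.range (j + 1), D i with hE
  have hE1 : 1 ≤ E := le_add_of_nonneg_right (Finset.sum_nonneg fun i _ => hD0 i)
  refine ⟨j.factorial * (j.factorial : ℝ) * E ^ j, r ^ 2 + 1, by positivity,
    fun f hf M hM v hv => ?_⟩
  have hM0 : 0 ≤ M := (norm_nonneg _).trans (hM 0 (by rw [norm_zero]; positivity))
  have hg : ContDiff ℝ ∞ fun x : ℝ => f x :=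
    (hf.contDiff.restrict_scalars ℝ).comp Complex.ofRealCLM.contDiff
  have key := norm_iteratedFDeriv_comp_le (𝕜 := ℝ) (n := j) (C := j.factorial * M) (D := E) hg hq
    (by exact_mod_cast le_top) v ?_ ?_
  · calc _ ≤ _ := key
      _ = _ := by ring
  · intro i hi
    rw [norm_iteratedFDeriv_eq_norm_iteratedDeriv, iteratedDeriv_comp_ofReal hf]
    have hc := Complex.norm_iteratedDeriv_le_of_forall_mem_sphere_norm_le
      (c := ((‖v‖ ^ 2 : ℝ) : ℂ)) (C := M) i one_pos hf.diffContOnCl (fun z hz => hM z ?_)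
    · refine hc.trans ?_
      rw [one_pow, div_one]
      gcongr
    · have h1 : ‖z - ((‖v‖ ^ 2 : ℝ) : ℂ)‖ = 1 := mem_sphere_iff_norm.1 hz
      have h2 : ‖z‖ ≤ ‖z - ((‖v‖ ^ 2 : ℝ) : ℂ)‖ + ‖((‖v‖ ^ 2 : ℝ) : ℂ)‖ := by
        have := norm_add_le (z - ((‖v‖ ^ 2 : ℝ) : ℂ)) ((‖v‖ ^ 2 : ℝ) : ℂ)
        rwa [sub_add_cancel] at this
      rw [h1, Complex.norm_real, Real.norm_of_nonneg (by positivity)] at h2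
      have h3 : ‖v‖ ^ 2 ≤ r ^ 2 := by gcongr; exact hr v hv
      linarith
  · intro i hi1 hij
    calc _ ≤ D i := hD i v hv
      _ ≤ E := by
          have := Finset.single_le_sum (f := D) (fun i _ => hD0 i)
            (Finset.mem_range.2 (Nat.lt_succ_of_le hij))
          linarith
      _ ≤ E ^ i := le_self_pow₀ hE1 (by omega)

/-- The linear functional `T` on `C^∞(V)` is bounded on the functions `v ↦ f (|v| ^ 2)`, with `f`
entire, by a multiple of the maximum of `f` on a disk. -/
def IsRadiallyBounded (T : SmoothFun V →ₗ[ℂ] ℂ) : Prop :=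
  ∃ C R : ℝ, 0 ≤ C ∧ 0 ≤ R ∧ ∀ (f : ℂ → ℂ) (hf : Differentiable ℂ f) (M : ℝ),
    (∀ z, ‖z‖ ≤ R → ‖f z‖ ≤ M) → ‖T (radialSmooth V f hf)‖ ≤ C * M

theorem SmoothFun.tendsto_zero {ι : Type*} {l : Filter ι} {f : ι → SmoothFun V}
    (h : ∀ (j : ℕ) (K : Set V), IsCompact K → ∀ ε > 0,
      ∀ᶠ i in l, ∀ v ∈ K, ‖iteratedFDeriv ℝ j (f i) v‖ < ε) :
    Tendsto f l (𝓝 0) := by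
  rw [nhds_iInf, tendsto_iInf]
  intro j
  rw [nhds_induced, tendsto_comap_iff,
    ContinuousMap.tendsto_iff_forall_isCompact_tendstoUniformlyOn]
  intro K hK
  rw [Metric.tendstoUniformlyOn_iff]
  intro ε hε
  filter_upwards [h j K hK ε hε] with i hi v hv
  have h0 : (SmoothFun.deriv j (0 : SmoothFun V)) v = 0 := by
    change iteratedFDeriv ℝ j (0 : V → ℂ) v = 0
    simp
  rw [h0, dist_zero_left]
  exact hi v hv

/-- If the bound failed with `C = N + 1`, `R = N` for every `N`, rescaling would give `f_N` with
`T(f_N(|v|²)) = 1` and `|f_N| ≤ 1/(N+1)` on the disk of radius `N`. By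
`norm_iteratedFDeriv_radialSmooth_le` these functions tend to `0` in `ℰ(V)`, against the continuity
of `T`. -/
theorem CompactDistribution.isRadiallyBounded (T : CompactDistribution V) :
    IsRadiallyBounded (T : SmoothFun V →ₗ[ℂ] ℂ) := by
  by_contra hcon
  have h1 : ∀ N : ℕ, ∃ (f : ℂ → ℂ) (hf : Differentiable ℂ f),
      T (radialSmooth V f hf) = 1 ∧ ∀ z, ‖z‖ ≤ N → ‖f z‖ ≤ 1 / (N + 1) := by
    intro N
    simp only [IsRadiallyBounded, not_exists, not_and, not_forall, not_le] at hcon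
    obtain ⟨f, hf, M, hM, hlt⟩ := hcon (N + 1) N (by positivity) (by positivity)
    rw [ContinuousLinearMap.coe_coe] at hlt
    have hM0 : 0 ≤ M := (norm_nonneg _).trans (hM 0 (by simp))
    have hT : 0 < ‖T (radialSmooth V f hf)‖ := lt_of_le_of_lt (by positivity) hlt
    have hT0 : T (radialSmooth V f hf) ≠ 0 := norm_pos_iff.1 hT
    refine ⟨fun z => (T (radialSmooth V f hf))⁻¹ * f z, hf.const_mul _, ?_, fun z hz => ?_⟩
    · have : radialSmooth V (fun z => (T (radialSmooth V f hf))⁻¹ * f z) (hf.const_mul _) =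
        (T (radialSmooth V f hf))⁻¹ • radialSmooth V f hf := rfl
      rw [this, map_smul, smul_eq_mul, inv_mul_cancel₀ hT0]
    · rw [norm_mul, norm_inv, inv_mul_le_iff₀ hT]
      calc _ ≤ M := hM z hz
        _ = (N + 1) * M * (1 / (N + 1)) := by field_simp
        _ ≤ _ := by gcongr
  choose f hf hT hb using h1
  have h2 : Tendsto (fun N => radialSmooth V (f N) (hf N)) atTop (𝓝 0) := by
    refine SmoothFun.tendsto_zero fun j K hK ε hε => ?_
    obtain ⟨C, R, hC, hCR⟩ := norm_iteratedFDeriv_radialSmooth_le hK j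
    have h3 : Tendsto (fun N : ℕ => C * (1 / ((N : ℝ) + 1))) atTop (𝓝 0) := by
      simpa using tendsto_one_div_add_atTop_nhds_zero_nat.const_mul C
    obtain ⟨N₀, hN₀⟩ := exists_nat_ge R
    filter_upwards [h3.eventually_lt_const hε, eventually_ge_atTop N₀] with N hN hNN v hv
    refine lt_of_le_of_lt (hCR (f N) (hf N) _ (fun z hz => hb N z (hz.trans (hN₀.trans ?_))) v hv) hN
    exact_mod_cast hNN
  have h3 := (T.continuous.tendsto 0).comp h2
  rw [map_zero] at h3
  have h4 : (⇑T ∘ fun N => radialSmooth V (f N) (hf N)) = fun _ => 1 := funext hT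
  rw [h4] at h3
  exact one_ne_zero (tendsto_nhds_unique tendsto_const_nhds h3)

/-- The power series with coefficients `b` converges everywhere, absolutely. -/
def IsEntireSeries (b : ℕ → ℂ) : Prop := ∀ R : ℝ, 0 ≤ R → Summable fun k => ‖b k‖ * R ^ k

theorem IsEntireSeries.mul_bounded {b μ : ℕ → ℂ} (hb : IsEntireSeries b) {B : ℝ}
    (hμ : ∀ k, ‖μ k‖ ≤ B) : IsEntireSeries fun k => b k * μ k := fun R hR => by
  refine Summable.of_nonneg_of_le (fun k => by positivity) (fun k => ?_) ((hb R hR).mul_left B)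
  rw [norm_mul]
  calc _ = ‖μ k‖ * (‖b k‖ * R ^ k) := by ring
    _ ≤ _ := by gcongr; exact hμ k

theorem IsEntireSeries.summable {b : ℕ → ℂ} (hb : IsEntireSeries b) (z : ℂ) :
    Summable fun k => b k * z ^ k := by
  refine Summable.of_norm ?_
  simpa only [norm_mul, norm_pow] using hb ‖z‖ (norm_nonneg z)

theorem IsEntireSeries.differentiable {b : ℕ → ℂ} (hb : IsEntireSeries b) :
    Differentiable ℂ fun z => ∑' k, b k * z ^ k := by
  intro z
  have h1 : DifferentiableOn ℂ (fun z => ∑' k, b k * z ^ k) (Metric.ball 0 (‖z‖ + 1)) := by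
    refine Complex.differentiableOn_tsum_of_summable_norm (hb (‖z‖ + 1) (by positivity))
      (fun k => by fun_prop) Metric.isOpen_ball fun k w hw => ?_
    rw [norm_mul, norm_pow]
    have := (mem_ball_zero_iff.1 hw).le
    gcongr
  exact h1.differentiableAt (Metric.isOpen_ball.mem_nhds (by simp))

/-- The smooth function `v ↦ ∑ k, b k * |v| ^ (2 k)`. -/
noncomputable def radialSeries (V : Type*) [NormedAddCommGroup V] [InnerProductSpace ℝ V]
    (b : ℕ → ℂ) (hb : IsEntireSeries b) : SmoothFun V :=
  radialSmooth V _ hb.differentiable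

/-- The smooth function `v ↦ |v| ^ (2 k)`. -/
def normPow (V : Type*) [NormedAddCommGroup V] [InnerProductSpace ℝ V] (k : ℕ) : SmoothFun V :=
  radialSmooth V (fun z => z ^ k) (differentiable_pow k)

theorem IsRadiallyBounded.summable {T : SmoothFun V →ₗ[ℂ] ℂ} (hT : IsRadiallyBounded T) {b : ℕ → ℂ}
    (hb : IsEntireSeries b) : Summable fun k => ‖b k * T (normPow V k)‖ := by
  obtain ⟨C, R, hC, hR, hCR⟩ := hT
  refine Summable.of_nonneg_of_le (fun k => norm_nonneg _) (fun k => ?_) ((hb R hR).mul_left C)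
  rw [norm_mul]
  have : ‖T (normPow V k)‖ ≤ C * R ^ k := hCR _ _ _ fun z hz => by rw [norm_pow]; gcongr
  calc _ ≤ ‖b k‖ * (C * R ^ k) := by gcongr
    _ = _ := by ring

/-- The tail of the series is again entire and small on the disk, so the disk bound alone justifies
applying `T` term by term. -/
theorem IsRadiallyBounded.apply_radialSeries {T : SmoothFun V →ₗ[ℂ] ℂ} (hT : IsRadiallyBounded T)
    {b : ℕ → ℂ} (hb : IsEntireSeries b) :
    T (radialSeries V b hb) = ∑' k, b k * T (normPow V k) := by
  have hsum := (hT.summable hb).of_norm.hasSum.tendsto_sum_nat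
  obtain ⟨C, R, hC, hR, hCR⟩ := hT
  refine tendsto_nhds_unique ?_ hsum
  have htail := (tendsto_sum_nat_add fun k => ‖b k‖ * R ^ k).const_mul C
  rw [mul_zero] at htail
  refine tendsto_iff_norm_sub_tendsto_zero.2 (squeeze_zero (fun _ => norm_nonneg _) (fun N => ?_) htail)
  have hdN : Differentiable ℂ fun z : ℂ => ∑ k ∈ Finset.range N, b k * z ^ k := by fun_prop
  have e1 : radialSmooth V _ (hb.differentiable.sub hdN) =
      radialSeries V b hb - ∑ k ∈ Finset.range N, b k • normPow V k := by
    have e2 : radialSmooth V _ hdN = ∑ k ∈ Finset.range N, b k • normPow V k := by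
      -- The induction on `N` must not carry along the facts already proved about this `N`.
      clear * -
      induction N with
      | zero => rfl
      | succ N ih =>
        rw [Finset.sum_range_succ, ← ih (by fun_prop)]
        refine Subtype.ext (funext fun v => ?_)
        exact Finset.sum_range_succ _ _
    rw [← e2]
    rfl
  have e3 : ∑ k ∈ Finset.range N, b k * T (normPow V k) =
      T (∑ k ∈ Finset.range N, b k • normPow V k) := by simp
  rw [e3, norm_sub_rev, ← map_sub, ← e1]
  refine hCR _ _ _ fun z hz => ?_
  have h1 : (∑' k, b k * z ^ k) - ∑ k ∈ Finset.range N, b k * z ^ k =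
      ∑' k, b (k + N) * z ^ (k + N) := by
    rw [← (hb.summable z).sum_add_tsum_nat_add N, add_sub_cancel_left]
  change ‖(∑' k, b k * z ^ k) - ∑ k ∈ Finset.range N, b k * z ^ k‖ ≤ _
  rw [h1]
  refine tsum_of_norm_bounded ((summable_nat_add_iff N).2 (hb R hR)).hasSum fun k => ?_
  rw [norm_mul, norm_pow]
  gcongr

variable [MeasurableSpace V] [BorelSpace V]

theorem integrable_smoothFun_mul (f : SmoothFun V) (φ : TestFun V) :
    Integrable fun v => f v * φ v :=
  (f.contDiff.continuous.mul φ.continuous).integrable_of_hasCompactSupport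
    (φ.hasCompactSupport.mul_left)

/-- The linear functional `f ↦ ∫ f φ` on `C^∞(V)` given by a test function `φ`. -/
noncomputable def testPairing (φ : TestFun V) : SmoothFun V →ₗ[ℂ] ℂ where
  toFun f := ∫ v, f v * φ v
  map_add' f g := by
    rw [← integral_add (integrable_smoothFun_mul f φ) (integrable_smoothFun_mul g φ)]
    exact integral_congr_ae (ae_of_all _ fun v => add_mul _ _ _)
  map_smul' c f := by
    rw [RingHom.id_apply, smul_eq_mul, ← integral_const_mul]
    exact integral_congr_ae (ae_of_all _ fun v => mul_assoc _ _ _)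

theorem testPairing_apply (φ : TestFun V) (f : SmoothFun V) :
    testPairing φ f = ∫ v, f v * φ v := rfl

/-- The disk has radius `r²`, where the support of `φ` lies in the ball of radius `r`, because `f`
is evaluated at `|v|²`. -/
theorem isRadiallyBounded_testPairing (φ : TestFun V) : IsRadiallyBounded (testPairing φ) := by
  obtain ⟨r, hr⟩ := φ.hasCompactSupport.isCompact.isBounded.exists_norm_le
  have hφ : Integrable φ := φ.continuous.integrable_of_hasCompactSupport φ.hasCompactSupport
  refine ⟨∫ v, ‖φ v‖, r ^ 2, integral_nonneg fun _ => norm_nonneg _, sq_nonneg r,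
    fun f hf M hM => ?_⟩
  rw [testPairing_apply, ← integral_mul_const]
  refine norm_integral_le_of_norm_le (hφ.norm.mul_const _) (ae_of_all _ fun v => ?_)
  by_cases hv : v ∈ tsupport φ
  · rw [norm_mul, mul_comm]
    gcongr
    refine hM _ ?_
    rw [Complex.norm_real, Real.norm_of_nonneg (by positivity)]
    gcongr
    exact hr v hv
  · simp [image_eq_zero_of_notMem_tsupport hv]

/-- The distribution given by a smooth function. -/
noncomputable def smoothDistr (f : SmoothFun V) : Distr V :=
  TestFunction.integralAgainstBilinCLM (ContinuousLinearMap.mul ℂ ℂ) volume (fun v => f v)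

theorem smoothDistr_apply (f : SmoothFun V) (φ : TestFun V) :
    smoothDistr f φ = ∫ v, f v * φ v := by
  rw [smoothDistr, TestFunction.integralAgainstBilinCLM_eq_integral
    (f.contDiff.continuous.locallyIntegrable.locallyIntegrableOn _)]
  simp [mul_comm]

end RadialSmooth

/-! ### Partial fraction series with poles at `n, n + 2, n + 4, …`, and their finite parts. -/

section PoleSeries

theorem one_le_norm_pole_sub {n k : ℕ} {ζ : ℂ} (hk : ‖ζ‖ + 1 ≤ k) : 1 ≤ ‖(n : ℂ) + 2 * k - ζ‖ := by
  have h1 : ‖(n : ℂ) + 2 * k‖ = n + 2 * k := by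
    rw [show (n : ℂ) + 2 * k = ((n + 2 * k : ℕ) : ℂ) by push_cast; ring, Complex.norm_natCast]
    push_cast; ring
  have h2 := norm_sub_norm_le ((n : ℂ) + 2 * k) ζ
  have h3 : (0 : ℝ) ≤ n := Nat.cast_nonneg n
  have := norm_nonneg ζ
  linarith

/-- No exception is needed when `ζ` is itself a pole: the singular term is then `0⁻¹ = 0`. The
series below therefore converge at every point. -/
theorem exists_norm_inv_pole_sub_le (n : ℕ) (ζ : ℂ) :
    ∃ B : ℝ, 0 ≤ B ∧ ∀ k : ℕ, ‖((n : ℂ) + 2 * k - ζ)⁻¹‖ ≤ B := by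
  obtain ⟨K, hK⟩ := exists_nat_ge (‖ζ‖ + 1)
  have h0 : ∀ k, 0 ≤ ‖((n : ℂ) + 2 * (k : ℕ) - ζ)⁻¹‖ := fun k => norm_nonneg _
  have h1 := Finset.sum_nonneg fun k (_ : k ∈ Finset.range K) => h0 k
  refine ⟨1 + ∑ k ∈ Finset.range K, ‖((n : ℂ) + 2 * k - ζ)⁻¹‖, by linarith, fun k => ?_⟩
  rcases lt_or_ge k K with hk | hk
  · have := Finset.single_le_sum (f := fun k : ℕ => ‖((n : ℂ) + 2 * k - ζ)⁻¹‖) (fun k _ => h0 k)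
      (Finset.mem_range.2 hk)
    linarith
  · have := one_le_norm_pole_sub (n := n) (ζ := ζ) (hK.trans (by exact_mod_cast hk) : ‖ζ‖ + 1 ≤ k)
    rw [norm_inv]
    have := inv_le_one_of_one_le₀ this
    linarith

/-- The sum of the partial fractions with coefficients `w` and poles `n, n + 2, n + 4, …`. -/
noncomputable def poleSeries (n : ℕ) (w : ℕ → ℂ) (ζ : ℂ) : ℂ := ∑' k, w k * ((n : ℂ) + 2 * k - ζ)⁻¹

theorem summable_poleSeries (n : ℕ) {w : ℕ → ℂ} (hw : Summable fun k => ‖w k‖) (ζ : ℂ) :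
    Summable fun k => w k * ((n : ℂ) + 2 * k - ζ)⁻¹ := by
  obtain ⟨B, hB, h⟩ := exists_norm_inv_pole_sub_le n ζ
  refine Summable.of_norm_bounded (hw.mul_right B) fun k => ?_
  rw [norm_mul]
  exact mul_le_mul_of_nonneg_left (h k) (norm_nonneg _)

/-- Near `ζ₀` all but finitely many terms are dominated by `‖w k‖`. A pole at `ζ₀` is harmless if
its coefficient vanishes, which is the situation once a singular term has been removed. -/
theorem analyticAt_poleSeries (n : ℕ) {w : ℕ → ℂ} (hw : Summable fun k => ‖w k‖) {ζ₀ : ℂ}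
    (h : ∀ k, w k = 0 ∨ (n : ℂ) + 2 * k ≠ ζ₀) : AnalyticAt ℂ (poleSeries n w) ζ₀ := by
  obtain ⟨K, hK⟩ := exists_nat_ge (‖ζ₀‖ + 2)
  have e1 : poleSeries n w = fun ζ => ∑ k ∈ Finset.range K, w k * ((n : ℂ) + 2 * k - ζ)⁻¹ +
      ∑' k, w (k + K) * ((n : ℂ) + 2 * (k + K : ℕ) - ζ)⁻¹ := by
    ext ζ
    exact ((summable_poleSeries n hw ζ).sum_add_tsum_nat_add K).symm
  have hlow : ∀ k, ∀ ζ ∈ Metric.ball ζ₀ 1, 1 ≤ ‖(n : ℂ) + 2 * (k + K : ℕ) - ζ‖ := fun k ζ hζ => by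
    refine one_le_norm_pole_sub ?_
    have h1 : ‖ζ - ζ₀‖ < 1 := mem_ball_iff_norm.1 hζ
    have h2 := norm_le_norm_add_norm_sub' ζ ζ₀
    push_cast
    have : (0 : ℝ) ≤ k := Nat.cast_nonneg k
    linarith
  rw [e1]
  refine AnalyticAt.add (Finset.analyticAt_fun_sum _ fun k _ => ?_) ?_
  · rcases h k with h0 | h0
    · simp only [h0, zero_mul]
      exact analyticAt_const
    · exact analyticAt_const.mul ((analyticAt_const.sub analyticAt_id).inv (sub_ne_zero.2 h0))
  · refine DifferentiableOn.analyticAt (s := Metric.ball ζ₀ 1) ?_ (Metric.ball_mem_nhds _ one_pos)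
    refine Complex.differentiableOn_tsum_of_summable_norm ((summable_nat_add_iff K).2 hw)
      (fun k => ?_) Metric.isOpen_ball fun k ζ hζ => ?_
    · refine (DifferentiableOn.inv (by fun_prop) fun ζ hζ => ?_).const_mul _
      exact norm_pos_iff.1 (lt_of_lt_of_le one_pos (hlow k ζ hζ))
    · rw [norm_mul, norm_inv]
      exact mul_le_of_le_one_right (norm_nonneg _) (inv_le_one_of_one_le₀ (hlow k ζ hζ))

open Classical in
/-- The coefficient of the `k`-th Taylor coefficient of the heat kernel in `Ψ_{m,α}`. -/
noncomputable def diffWeight (n m : ℕ) (α : ℂ) (k : ℕ) : ℂ :=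
  -- If `2mα = n + 2k`, this summand is `0` by `0⁻¹ = 0`. Near such an `α` the weight at `z` is
  -- `Γ(z)⁻¹ / (z - α)`, whose constant term at `α` is the derivative of `1/Γ`.
  -(2 * m) * (Complex.Gamma α)⁻¹ * ((n : ℂ) + 2 * k - 2 * m * α)⁻¹ +
    if 2 * m * α = n + 2 * k then deriv (fun z => (Complex.Gamma z)⁻¹) α else 0

theorem exists_norm_diffWeight_le (n m : ℕ) (α : ℂ) : ∃ B : ℝ, ∀ k, ‖diffWeight n m α k‖ ≤ B := by
  obtain ⟨B, hB, h⟩ := exists_norm_inv_pole_sub_le n (2 * m * α)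
  refine ⟨‖-(2 * m) * (Complex.Gamma α)⁻¹‖ * B + ‖deriv (fun z => (Complex.Gamma z)⁻¹) α‖,
    fun k => (norm_add_le _ _).trans (add_le_add ?_ ?_)⟩
  · rw [norm_mul]
    gcongr
    exact h k
  · split_ifs
    · exact le_rfl
    · simp

/-- The pairing of `Ψ_{m,α}` with a functional whose moments determine the sequence `w`. -/
noncomputable def diffSeries (n m : ℕ) (w : ℕ → ℂ) (α : ℂ) : ℂ := ∑' k, w k * diffWeight n m α k

theorem diffSeries_of_not_isExceptional {n m : ℕ} {α : ℂ} (hα : ¬ IsExceptional n m α)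
    (w : ℕ → ℂ) : diffSeries n m w α =
      -(2 * m) * (Complex.Gamma α)⁻¹ * poleSeries n w (2 * m * α) := by
  rw [diffSeries, poleSeries, ← tsum_mul_left]
  congr 1; ext k
  have : ¬ (2 * m * α = n + 2 * k) := fun h => hα ⟨k, h⟩
  rw [diffWeight, if_neg this]
  ring

theorem isClosed_isExceptional (n : ℕ) {m : ℕ} : IsClosed {α | IsExceptional n m α} := by
  have h1 : IsClosed (Set.range fun k : ℕ => ((n + 2 * k : ℕ) : ℂ)) := by
    have : Set.range (fun k : ℕ => ((n + 2 * k : ℕ) : ℂ)) =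
        ((↑) : ℤ → ℂ) '' Set.range (fun k : ℕ => ((n + 2 * k : ℕ) : ℤ)) := by
      rw [← Set.range_comp]; congr 1
    rw [this]
    exact Complex.isClosedEmbedding_intCast.isClosedMap _ (isClosed_discrete _)
  have h2 : {α | IsExceptional n m α} = (fun α : ℂ => 2 * m * α) ⁻¹'
      Set.range fun k : ℕ => ((n + 2 * k : ℕ) : ℂ) := by
    ext α
    simp only [IsExceptional, Set.mem_ofPred_eq, Set.mem_preimage, Set.mem_range]
    exact exists_congr fun k => by push_cast; exact eq_comm
  rw [h2]
  exact h1.preimage (by fun_prop)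

theorem eventually_not_isExceptional {n m : ℕ} {α : ℂ} (hα : ¬ IsExceptional n m α) :
    ∀ᶠ z in 𝓝 α, ¬ IsExceptional n m z :=
  (isClosed_isExceptional n).isOpen_compl.mem_nhds hα

theorem analyticAt_Gamma_inv (α : ℂ) : AnalyticAt ℂ (fun z => (Complex.Gamma z)⁻¹) α :=
  Complex.differentiable_one_div_Gamma.analyticAt α

theorem analyticAt_diffSeries {n m : ℕ} {w : ℕ → ℂ} (hw : Summable fun k => ‖w k‖) {α : ℂ}
    (hα : ¬ IsExceptional n m α) : AnalyticAt ℂ (diffSeries n m w) α := by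
  have h1 : (fun z => -(2 * m) * (Complex.Gamma z)⁻¹ * poleSeries n w (2 * m * z)) =ᶠ[𝓝 α]
      diffSeries n m w := by
    filter_upwards [eventually_not_isExceptional hα] with z hz
    exact (diffSeries_of_not_isExceptional hz w).symm
  refine AnalyticAt.congr ?_ h1
  refine (analyticAt_const.mul (analyticAt_Gamma_inv α)).mul ?_
  refine AnalyticAt.fun_comp (f := fun z : ℂ => 2 * m * z)
    (analyticAt_poleSeries n hw fun k => Or.inr fun h => hα ⟨k, h.symm⟩) ?_
  exact analyticAt_const.mul analyticAt_id

/-- Only the term `k₀` is singular. Writing `1/Γ(z) = 1/Γ(α) + (z - α) · dslope` splits it into a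
simple pole, possibly with residue `0`, and an analytic part whose value at `α` is the derivative
built into `diffWeight`. -/
theorem exists_diffSeries_eq_of_isExceptional {n m : ℕ} (hm : 1 ≤ m) {w : ℕ → ℂ}
    (hw : Summable fun k => ‖w k‖) {α : ℂ} (hα : IsExceptional n m α) :
    ∃ (c : ℂ) (g : ℂ → ℂ), AnalyticAt ℂ g α ∧ g α = diffSeries n m w α ∧
      (∀ᶠ z in 𝓝[≠] α, ¬ IsExceptional n m z) ∧
      ∀ᶠ z in 𝓝[≠] α, diffSeries n m w z = c * (z - α)⁻¹ + g z := by
  obtain ⟨k₀, hk₀⟩ := hα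
  have hm0 : (m : ℂ) ≠ 0 := by exact_mod_cast (by omega : m ≠ 0)
  set w' : ℕ → ℂ := Function.update w k₀ 0 with hw'
  have hw's : Summable fun k => ‖w' k‖ := by
    refine Summable.of_nonneg_of_le (fun k => norm_nonneg _) (fun k => ?_) hw
    rcases eq_or_ne k k₀ with rfl | h <;> simp [*]
  have hsplit : ∀ ζ, poleSeries n w ζ =
      w k₀ * ((n : ℂ) + 2 * k₀ - ζ)⁻¹ + poleSeries n w' ζ := fun ζ => by
    have h1 := (summable_poleSeries n hw's ζ).hasSum.update k₀ (w k₀ * ((n : ℂ) + 2 * k₀ - ζ)⁻¹)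
    have h2 : Function.update (fun k => w' k * ((n : ℂ) + 2 * k - ζ)⁻¹) k₀
        (w k₀ * ((n : ℂ) + 2 * k₀ - ζ)⁻¹) = fun k => w k * ((n : ℂ) + 2 * k - ζ)⁻¹ := by
      ext k
      rcases eq_or_ne k k₀ with rfl | h <;> simp [*]
    rw [h2] at h1
    rw [poleSeries, h1.tsum_eq, poleSeries]
    simp [hw']
  set G : ℂ → ℂ := fun z => (Complex.Gamma z)⁻¹ with hG
  have hGd : AnalyticAt ℂ (dslope G α) α := by
    refine Differentiable.analyticAt ?_ α
    rw [← differentiableOn_univ, Complex.differentiableOn_dslope univ_mem, differentiableOn_univ]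
    exact Complex.differentiable_one_div_Gamma
  have hiso : ∀ᶠ z in 𝓝[≠] α, ¬ IsExceptional n m z := by
    -- Distinct exceptional values of `2mα` are at least `2` apart.
    have hlt : (fun z : ℂ => ‖2 * m * z - 2 * m * α‖) ⁻¹' Set.Iio 2 ∈ 𝓝 α := by
      refine (Continuous.isOpen_preimage (by fun_prop) _ isOpen_Iio).mem_nhds ?_
      simp
    filter_upwards [self_mem_nhdsWithin, nhdsWithin_le_nhds hlt] with z hz hz2
    rintro ⟨k, hk⟩
    have h3 : ‖(2 : ℂ) * ((k : ℤ) - (k₀ : ℤ) : ℤ)‖ < 2 := by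
      have : (2 : ℂ) * ((k : ℤ) - (k₀ : ℤ) : ℤ) = 2 * m * z - 2 * m * α := by
        rw [hk, hk₀]; push_cast; ring
      rw [this]; exact hz2
    rw [norm_mul, Complex.norm_intCast, Complex.norm_ofNat] at h3
    have h4 : |((k : ℤ) - (k₀ : ℤ) : ℤ)| < 1 := by
      have : |(((k : ℤ) - (k₀ : ℤ) : ℤ) : ℝ)| < 1 := by linarith
      exact_mod_cast this
    have h5 : k = k₀ := by rw [Int.abs_lt_one_iff] at h4; omega
    refine hz ?_
    rw [h5, ← hk₀] at hk
    exact mul_left_cancel₀ (mul_ne_zero two_ne_zero hm0) hk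
  refine ⟨w k₀ * G α, fun z => w k₀ * dslope G α z + -(2 * m) * G z * poleSeries n w' (2 * m * z),
    ?_, ?_, hiso, ?_⟩
  · refine (analyticAt_const.mul hGd).add ((analyticAt_const.mul (analyticAt_Gamma_inv α)).mul ?_)
    refine AnalyticAt.fun_comp (f := fun z : ℂ => 2 * m * z)
      (analyticAt_poleSeries n hw's fun k => ?_) (analyticAt_const.mul analyticAt_id)
    rcases eq_or_ne k k₀ with rfl | h
    · exact Or.inl (by simp [hw'])
    · refine Or.inr fun h' => h ?_
      rw [hk₀] at h'
      have h2 : (2 : ℂ) * k = 2 * k₀ := add_left_cancel h'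
      exact_mod_cast mul_left_cancel₀ two_ne_zero h2
  · have h1 : diffSeries n m w α = -(2 * m) * G α * poleSeries n w (2 * m * α) +
        w k₀ * deriv G α := by
      have h2 := (summable_poleSeries n hw (2 * m * α)).hasSum.mul_left (-(2 * m) * G α)
      have h3 := h2.add (hasSum_ite_eq k₀ (w k₀ * deriv G α))
      rw [diffSeries, poleSeries, ← h3.tsum_eq]
      congr 1; ext k
      simp only [diffWeight]
      rcases eq_or_ne k k₀ with rfl | h
      · rw [if_pos hk₀, if_pos rfl]; ring
      · rw [if_neg h, if_neg]
        · ring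
        · intro h'
          rw [hk₀] at h'
          have h2 : (2 : ℂ) * k₀ = 2 * k := add_left_cancel h'
          exact h (by exact_mod_cast (mul_left_cancel₀ two_ne_zero h2).symm)
    simp only
    rw [h1, hsplit, hk₀, sub_self, inv_zero, mul_zero, zero_add, dslope_same]
    ring
  · filter_upwards [self_mem_nhdsWithin, hiso] with z hz hz2
    have hz0 : z - α ≠ 0 := sub_ne_zero.2 hz
    rw [diffSeries_of_not_isExceptional hz2, hsplit, dslope_of_ne _ hz, slope_def_field, ← hk₀,
      show 2 * m * α - 2 * m * z = -(2 * m) * (z - α) by ring]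
    simp only [hG]
    field_simp
    ring

theorem meromorphic_diffSeries {n m : ℕ} (hm : 1 ≤ m) {w : ℕ → ℂ}
    (hw : Summable fun k => ‖w k‖) (α : ℂ) : MeromorphicAt (diffSeries n m w) α := by
  by_cases hα : IsExceptional n m α
  · obtain ⟨c, g, hg, -, -, h⟩ := exists_diffSeries_eq_of_isExceptional hm hw hα
    refine MeromorphicAt.congr (f := fun z => c * (z - α)⁻¹ + g z) ?_ (h.mono fun z hz => hz.symm)
    exact ((MeromorphicAt.const c α).mul
      ((MeromorphicAt.id α).sub (MeromorphicAt.const α α)).inv).add hg.meromorphicAt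
  · exact (analyticAt_diffSeries hw hα).meromorphicAt

end PoleSeries

/-! ### Power series expansion of the heat kernel in `|v|²`. -/

section HeatSeries

open Set

/-- From `r y ≤ (r² + y²)/2` and `y² ≤ 1 + y^(2m)`: half of the exponential decay absorbs the linear
growth. -/
theorem exp_mul_sub_pow_le {m : ℕ} (hm : 1 ≤ m) (r : ℝ) {y : ℝ} (hy : 0 ≤ y) :
    Real.exp (r * y) * Real.exp (-(1 * y ^ (2 * m))) ≤
      Real.exp ((1 + r ^ 2) / 2) * Real.exp (-(1 / 2 * y ^ (2 * m))) := by
  rw [← Real.exp_add, ← Real.exp_add, Real.exp_le_exp]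
  have h1 : y ^ 2 ≤ 1 + y ^ (2 * m) := by
    rcases le_total y 1 with h | h
    · have : y ^ 2 ≤ 1 := pow_le_one₀ hy h
      have : 0 ≤ y ^ (2 * m) := by positivity
      linarith
    · have : y ^ 2 ≤ y ^ (2 * m) := pow_le_pow_right₀ h (by omega)
      linarith
  nlinarith [sq_nonneg (r - y)]

theorem Real.cosh_le_exp_abs (x : ℝ) : Real.cosh x ≤ Real.exp |x| := by
  rw [← Real.cosh_abs, Real.cosh_eq]
  have : Real.exp (-|x|) ≤ Real.exp |x| := Real.exp_le_exp.2 (by have := abs_nonneg x; linarith)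
  linarith

variable (V : Type*) [NormedAddCommGroup V] [InnerProductSpace ℝ V] [FiniteDimensional ℝ V]
  [MeasurableSpace V] [BorelSpace V]

/-- Some unit vector. -/
noncomputable def unitVector [Nontrivial V] : V := (exists_norm_eq V zero_le_one).choose

theorem norm_unitVector [Nontrivial V] : ‖unitVector V‖ = 1 :=
  (exists_norm_eq V zero_le_one).choose_spec

theorem abs_inner_unitVector_le [Nontrivial V] (ξ : V) : |inner ℝ (unitVector V) ξ| ≤ ‖ξ‖ := by
  have := abs_real_inner_le_norm (unitVector V) ξ
  rwa [norm_unitVector, one_mul] at this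

/-- The moment of order `2 k` of `exp (-|ξ| ^ (2 m))` in the direction of a unit vector. -/
noncomputable def evenMoment [Nontrivial V] (m k : ℕ) : ℝ :=
  ∫ ξ : V, inner ℝ (unitVector V) ξ ^ (2 * k) * Real.exp (-(1 * ‖ξ‖ ^ (2 * m)))

variable {V} in
theorem integrable_inner_pow_mul_exp [Nontrivial V] {m : ℕ} (hm : 1 ≤ m) (k : ℕ) :
    Integrable fun ξ : V =>
      inner ℝ (unitVector V) ξ ^ (2 * k) * Real.exp (-(1 * ‖ξ‖ ^ (2 * m))) := by
  refine (integrable_pow_norm_mul_exp_neg hm (2 * k) one_pos).mono'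
    (Continuous.aestronglyMeasurable (by fun_prop)) (ae_of_all _ fun ξ => ?_)
  rw [norm_mul, norm_pow, Real.norm_eq_abs, Real.norm_of_nonneg (Real.exp_nonneg _)]
  gcongr
  exact abs_inner_unitVector_le V ξ

theorem evenMoment_nonneg [Nontrivial V] (m k : ℕ) : 0 ≤ evenMoment V m k :=
  integral_nonneg fun ξ => mul_nonneg (by rw [pow_mul]; positivity) (Real.exp_nonneg _)

/-- The partial sums are bounded by `∫ cosh(√R ⟨e, ξ⟩) exp(-|ξ|^(2m)) dξ`, which is finite since the
decay is at least Gaussian. This is what makes the expansion entire. -/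
theorem summable_evenMoment [Nontrivial V] {m : ℕ} (hm : 1 ≤ m) {R : ℝ} (hR : 0 ≤ R) :
    Summable fun k : ℕ => R ^ k / ((2 * k).factorial : ℝ) * evenMoment V m k := by
  set r := √R with hr
  have hint : Integrable fun ξ : V => Real.exp (r * ‖ξ‖) * Real.exp (-(1 * ‖ξ‖ ^ (2 * m))) := by
    refine ((integrable_exp_neg_mul_pow_norm (V := V) hm one_half_pos).const_mul
      (Real.exp ((1 + r ^ 2) / 2))).mono' (Continuous.aestronglyMeasurable (by fun_prop))
      (ae_of_all _ fun ξ => ?_)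
    rw [Real.norm_of_nonneg (by positivity)]
    exact exp_mul_sub_pow_le hm r (norm_nonneg ξ)
  refine summable_of_sum_le (c := ∫ ξ : V, Real.exp (r * ‖ξ‖) * Real.exp (-(1 * ‖ξ‖ ^ (2 * m))))
    (fun k => mul_nonneg (by positivity) (evenMoment_nonneg V m k)) fun u => ?_
  simp only [evenMoment, ← integral_const_mul]
  rw [← integral_finsetSum _ fun k _ => (integrable_inner_pow_mul_exp hm k).const_mul _]
  refine integral_mono (integrable_finsetSum _ fun k _ =>
    (integrable_inner_pow_mul_exp hm k).const_mul _) hint fun ξ => ?_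
  simp only
  have h1 : ∀ k : ℕ, R ^ k / ((2 * k).factorial : ℝ) *
      (inner ℝ (unitVector V) ξ ^ (2 * k) * Real.exp (-(1 * ‖ξ‖ ^ (2 * m)))) =
      (r * inner ℝ (unitVector V) ξ) ^ (2 * k) / ((2 * k).factorial : ℝ) *
        Real.exp (-(1 * ‖ξ‖ ^ (2 * m))) := fun k => by
    rw [mul_pow, pow_mul r, hr, Real.sq_sqrt hR]
    ring
  simp only [h1]
  rw [← Finset.sum_mul]
  gcongr
  calc _ ≤ Real.cosh (r * inner ℝ (unitVector V) ξ) :=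
        sum_le_hasSum u (fun k _ => div_nonneg (by rw [pow_mul]; positivity) (by positivity))
          (Real.hasSum_cosh _)
    _ ≤ Real.exp |r * inner ℝ (unitVector V) ξ| := Real.cosh_le_exp_abs _
    _ ≤ _ := by
        rw [Real.exp_le_exp, abs_mul, abs_of_nonneg (Real.sqrt_nonneg R)]
        exact mul_le_mul_of_nonneg_left (abs_inner_unitVector_le V ξ) (Real.sqrt_nonneg R)

/-- The coefficients of the heat kernel at time `1` as a power series in `|v| ^ 2`. -/
noncomputable def heatCoeff [Nontrivial V] (m k : ℕ) : ℂ :=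
  ((2 * Real.pi : ℝ) : ℂ)⁻¹ ^ finrank ℝ V *
    ((-1) ^ k / ((2 * k).factorial : ℂ) * (evenMoment V m k : ℂ))

theorem isEntireSeries_heatCoeff [Nontrivial V] {m : ℕ} (hm : 1 ≤ m) :
    IsEntireSeries (heatCoeff V m) := fun R hR => by
  refine ((summable_evenMoment V hm hR).mul_left
    ‖((2 * Real.pi : ℝ) : ℂ)⁻¹ ^ finrank ℝ V‖).congr fun k => ?_
  rw [heatCoeff, norm_mul, norm_mul, norm_div, norm_pow (-1 : ℂ) k, norm_neg, norm_one, one_pow,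
    Complex.norm_natCast, Complex.norm_real, Real.norm_of_nonneg (evenMoment_nonneg V m k)]
  ring

variable {V}

theorem integrable_heatKernel_integrand [Nontrivial V] {m : ℕ} (hm : 1 ≤ m) {t : ℝ} (ht : 0 < t)
    (v : V) : Integrable fun ξ : V =>
      Complex.exp (Complex.I * (inner ℝ v ξ : ℝ) - ((t * ‖ξ‖ ^ (2 * m) : ℝ) : ℂ)) := by
  refine (integrable_exp_neg_mul_pow_norm hm ht).mono'
    (Continuous.aestronglyMeasurable (by fun_prop)) (ae_of_all _ fun ξ => ?_)
  rw [Complex.norm_exp, Complex.sub_re, Complex.ofReal_re]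
  simp

/-- Averaging over `ξ ↦ -ξ` replaces the exponential by a cosine, whose Taylor series is integrated
term by term. -/
theorem hasSum_heatKernel_smul_unitVector [Nontrivial V] {m : ℕ} (hm : 1 ≤ m) (r : ℝ) :
    HasSum (fun k => heatCoeff V m k * ((r ^ 2 : ℝ) : ℂ) ^ k)
      (heatKernel m 1 (r • unitVector V)) := by
  set W : V → ℝ := fun ξ => Real.exp (-(1 * ‖ξ‖ ^ (2 * m))) with hW
  set e := unitVector V with he
  set f : V → ℂ := fun ξ =>
    Complex.exp (Complex.I * (inner ℝ (r • e) ξ : ℝ) - ((1 * ‖ξ‖ ^ (2 * m) : ℝ) : ℂ)) with hf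
  have hfi : Integrable f := integrable_heatKernel_integrand hm one_pos _
  have h1 : ∫ ξ, f ξ = ∫ ξ, Complex.cos ((r * inner ℝ e ξ : ℝ) : ℂ) * (W ξ : ℂ) := by
    have h2 : ∫ ξ, f ξ = ∫ ξ, (f ξ + f (-ξ)) / 2 := by
      rw [integral_div, integral_add hfi hfi.comp_neg, integral_neg_eq_self]
      ring
    rw [h2]
    congr 1; ext ξ
    simp only [hf, hW]
    rw [inner_neg_right, norm_neg, real_inner_smul_left, Complex.cos, Complex.ofReal_exp,
      sub_eq_add_neg, sub_eq_add_neg, Complex.exp_add, Complex.exp_add, ← add_mul, mul_div_right_comm]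
    congr 3
    · rw [mul_comm]
    · congr 1; push_cast; ring
    · push_cast; ring
  set F : ℕ → V → ℂ := fun k ξ =>
    (((-1) ^ k * (r ^ 2) ^ k / ((2 * k).factorial : ℝ) * (inner ℝ e ξ ^ (2 * k) * W ξ) : ℝ) : ℂ)
    with hF
  have hFi : ∀ k, Integrable (F k) := fun k =>
    ((integrable_inner_pow_mul_exp hm k).const_mul _).ofReal
  have hFn : ∀ k ξ, ‖F k ξ‖ =
      (r ^ 2) ^ k / ((2 * k).factorial : ℝ) * (inner ℝ e ξ ^ (2 * k) * W ξ) := fun k ξ => by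
    have h0 : 0 ≤ inner ℝ e ξ ^ (2 * k) := by rw [pow_mul]; positivity
    simp only [hF, Complex.norm_real, norm_mul, norm_div, norm_pow, norm_neg, norm_one, one_pow,
      one_mul]
    simp only [Real.norm_eq_abs, sq_abs, Nat.abs_cast]
    rw [← abs_pow, abs_of_nonneg h0, abs_of_nonneg (Real.exp_nonneg _)]
  have hFs : Summable fun k => ∫ ξ, ‖F k ξ‖ := by
    refine (summable_evenMoment V hm (sq_nonneg r)).congr fun k => ?_
    simp only [hFn]
    rw [integral_const_mul, evenMoment]
  have key := hasSum_integral_of_summable_integral_norm hFi hFs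
  have e1 : ∫ ξ, ∑' k, F k ξ = ∫ ξ, f ξ := by
    rw [h1]
    congr 1; ext ξ
    have h3 := (Complex.hasSum_cos ((r * inner ℝ e ξ : ℝ) : ℂ)).mul_right (W ξ : ℂ)
    rw [← h3.tsum_eq]
    congr 1; ext k
    simp only [hF]
    push_cast
    ring
  have e2 := (e1 ▸ key).mul_left (((2 * Real.pi : ℝ) : ℂ)⁻¹ ^ finrank ℝ V)
  refine (e2.congr_fun fun k => ?_)
  simp only [hF]
  rw [integral_complex_ofReal, integral_const_mul, heatCoeff, evenMoment]
  push_cast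
  ring

/-- The reflection in the hyperplane orthogonal to `v - w` exchanges the two vectors and preserves
norm and measure. -/
theorem heatKernel_one_eq_of_norm_eq {m : ℕ} {v w : V} (h : ‖v‖ = ‖w‖) :
    heatKernel m 1 v = heatKernel m 1 w := by
  set e := (ℝ ∙ (v - w))ᗮ.reflection with he
  have hew : e v = w := Submodule.reflection_sub h
  symm
  rw [heatKernel, heatKernel,
    ← e.measurePreserving.integral_comp e.toHomeomorph.measurableEmbedding]
  congr 2; ext ξ
  have h2 : inner ℝ w (e ξ) = inner ℝ v ξ := by rw [← hew, e.inner_map_map]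
  have h3 : ‖e ξ‖ = ‖ξ‖ := e.norm_map ξ
  rw [h2, h3]

theorem hasSum_heatKernel_one [Nontrivial V] {m : ℕ} (hm : 1 ≤ m) (v : V) :
    HasSum (fun k => heatCoeff V m k * ((‖v‖ ^ 2 : ℝ) : ℂ) ^ k) (heatKernel m 1 v) := by
  rw [heatKernel_one_eq_of_norm_eq (w := ‖v‖ • unitVector V)
    (by rw [norm_smul, norm_unitVector, mul_one, norm_norm])]
  exact hasSum_heatKernel_smul_unitVector hm ‖v‖

/-- Substitute `ξ ↦ τξ`. With `τ = t^(1/(2m))` this reduces every time to time `1` and yields the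
exponents `-(n+2k)/(2m)`. -/
theorem heatKernel_eq_smul {m : ℕ} {τ : ℝ} (hτ : 0 < τ) (v : V) :
    heatKernel m (τ ^ (2 * m)) v =
      (((τ ^ finrank ℝ V)⁻¹ : ℝ) : ℂ) * heatKernel m 1 (τ⁻¹ • v) := by
  have h1 := Measure.integral_comp_smul_of_nonneg (volume : Measure V) (fun ξ : V =>
    Complex.exp (Complex.I * (inner ℝ (τ⁻¹ • v) ξ : ℝ) - ((1 * ‖ξ‖ ^ (2 * m) : ℝ) : ℂ))) τ
    (hR := hτ.le)
  rw [heatKernel, heatKernel, mul_left_comm, ← Complex.real_smul, ← h1]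
  congr 2; ext ξ
  rw [real_inner_smul_left, real_inner_smul_right, norm_smul, Real.norm_of_nonneg hτ.le, mul_pow,
    inv_mul_cancel_left₀ hτ.ne', one_mul]

/-- The expansion of the heat kernel as a power series. -/
theorem hasSum_heatKernel [Nontrivial V] {m : ℕ} (hm : 1 ≤ m) {t : ℝ} (ht : 0 < t) (v : V) :
    HasSum (fun k : ℕ => heatCoeff V m k *
      ((t ^ (-(finrank ℝ V + 2 * k) / (2 * m) : ℝ) : ℝ) : ℂ) * ((‖v‖ ^ 2 : ℝ) : ℂ) ^ k)
      (heatKernel m t v) := by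
  set τ := t ^ (1 / (2 * m) : ℝ) with hτ
  have hτ0 : 0 < τ := Real.rpow_pos_of_pos ht _
  have hm0 : (m : ℝ) ≠ 0 := by exact_mod_cast (by omega : m ≠ 0)
  have hτt : τ ^ (2 * m) = t := by
    rw [hτ, ← Real.rpow_natCast, ← Real.rpow_mul ht.le]
    push_cast
    rw [one_div, inv_mul_cancel₀ (by positivity), Real.rpow_one]
  have h1 := heatKernel_eq_smul (V := V) (m := m) hτ0 v
  rw [hτt] at h1
  rw [h1]
  refine ((hasSum_heatKernel_one hm (τ⁻¹ • v)).mul_left _).congr_fun fun k => ?_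
  have h2 : t ^ (-(finrank ℝ V + 2 * k) / (2 * m) : ℝ) =
      (τ ^ finrank ℝ V)⁻¹ * (τ⁻¹ ^ 2) ^ k := by
    rw [← pow_mul, inv_pow, ← mul_inv, ← pow_add, ← Real.rpow_natCast, hτ, ← Real.rpow_mul ht.le,
      ← Real.rpow_neg ht.le]
    congr 1
    push_cast
    field_simp
  rw [h2, norm_smul, Real.norm_of_nonneg (inv_nonneg.2 hτ0.le)]
  push_cast
  ring

/-- Polar coordinates, the volume of the unit ball and a one-dimensional Gamma integral. -/
theorem evenMoment_zero [Nontrivial V] {m : ℕ} (hm : 1 ≤ m) : evenMoment V m 0 =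
    Real.pi ^ (finrank ℝ V / 2 : ℝ) * Real.Gamma (finrank ℝ V / (2 * m)) /
      (Real.Gamma (finrank ℝ V / 2) * m) := by
  have hd : 0 < finrank ℝ V := finrank_pos
  have hdR : (0 : ℝ) < finrank ℝ V := by exact_mod_cast hd
  have hm0 : (0 : ℝ) < m := by exact_mod_cast hm
  have h1 := integral_fun_norm_addHaar (volume : Measure V)
    fun y : ℝ => Real.exp (-(1 * y ^ (2 * m)))
  have h2 : ∫ y in Ioi (0 : ℝ), y ^ (finrank ℝ V - 1) • Real.exp (-(1 * y ^ (2 * m))) =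
      1 / (2 * m) * Real.Gamma (finrank ℝ V / (2 * m)) := by
    have := integral_rpow_mul_exp_neg_rpow (p := ((2 * m : ℕ) : ℝ))
      (q := ((finrank ℝ V - 1 : ℕ) : ℝ)) (by positivity)
      (lt_of_lt_of_le (by norm_num) (Nat.cast_nonneg _))
    simp only [Real.rpow_natCast] at this
    simp only [smul_eq_mul, one_mul]
    rw [this]
    push_cast [Nat.cast_sub hd]
    rw [sub_add_cancel]
  have h3 : (volume : Measure V).real (Metric.ball 0 1) =
      Real.pi ^ (finrank ℝ V / 2 : ℝ) / Real.Gamma (finrank ℝ V / 2 + 1) := by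
    have hG := Real.Gamma_pos_of_pos (by positivity : (0 : ℝ) < finrank ℝ V / 2 + 1)
    rw [Measure.real, InnerProductSpace.volume_ball, ENNReal.ofReal_one, one_pow, one_mul,
      ENNReal.toReal_ofReal (by positivity), Real.sqrt_eq_rpow, ← Real.rpow_natCast,
      ← Real.rpow_mul Real.pi_pos.le]
    congr 2
    ring
  have hG := Real.Gamma_pos_of_pos (by positivity : (0 : ℝ) < finrank ℝ V / 2)
  simp only [evenMoment, mul_zero, pow_zero, one_mul] at h1 ⊢
  rw [h1]
  simp only [one_mul] at h2
  rw [h2, h3, Real.Gamma_add_one (by positivity), nsmul_eq_mul, smul_eq_mul]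
  field_simp

theorem heatCoeff_zero [Nontrivial V] {m : ℕ} (hm : 1 ≤ m) : heatCoeff V m 0 =
    Complex.Gamma (finrank ℝ V / (2 * m)) /
      (((4 * Real.pi : ℝ) : ℂ) ^ ((finrank ℝ V : ℂ) / 2) * Complex.Gamma (finrank ℝ V / 2) * m) := by
  have hpi := Real.pi_pos
  have h4 : (4 * Real.pi) ^ (finrank ℝ V / 2 : ℝ) =
      (2 * Real.pi) ^ finrank ℝ V / Real.pi ^ (finrank ℝ V / 2 : ℝ) := by
    rw [eq_div_iff (by positivity), ← Real.mul_rpow (by positivity) hpi.le,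
      show 4 * Real.pi * Real.pi = (2 * Real.pi) ^ (2 : ℝ) by rw [Real.rpow_two]; ring,
      ← Real.rpow_mul (by positivity), ← Real.rpow_natCast]
    congr 1; ring
  have h5 : heatCoeff V m 0 = (((2 * Real.pi)⁻¹ ^ finrank ℝ V * evenMoment V m 0 : ℝ) : ℂ) := by
    rw [heatCoeff]; simp
  have h6 : ((finrank ℝ V : ℂ) / (2 * m)) = ((finrank ℝ V / (2 * m) : ℝ) : ℂ) := by push_cast; rfl
  have h7 : ((finrank ℝ V : ℂ) / 2) = ((finrank ℝ V / 2 : ℝ) : ℂ) := by push_cast; rfl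
  rw [h5, h6, h7, Complex.Gamma_ofReal, Complex.Gamma_ofReal,
    ← Complex.ofReal_cpow (by positivity), ← Complex.ofReal_natCast, ← Complex.ofReal_mul,
    ← Complex.ofReal_mul, ← Complex.ofReal_div, evenMoment_zero hm, h4, inv_pow]
  congr 1
  field_simp

end HeatSeries

/-! ### The function `Ψ`, and its comparison with the Mellin integrals on the strip `0 < 2m Re α <
n`. -/

section Overlap

open Set

variable {V : Type*} [NormedAddCommGroup V] [InnerProductSpace ℝ V] [FiniteDimensional ℝ V]
  [MeasurableSpace V] [BorelSpace V]

theorem not_isExceptional_of_re_lt {n m : ℕ} {α : ℂ} (h : 2 * m * α.re < n) :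
    ¬ IsExceptional n m α := by
  rintro ⟨k, hk⟩
  have h1 := congrArg Complex.re hk
  rw [show (2 * m * α : ℂ) = ((2 * m : ℝ) : ℂ) * α by push_cast; ring, Complex.re_ofReal_mul,
    show (n + 2 * k : ℂ) = ((n + 2 * k : ℝ) : ℂ) by push_cast; ring, Complex.ofReal_re] at h1
  have : (0 : ℝ) ≤ k := Nat.cast_nonneg k
  linarith

variable (V) in
/-- The function `Ψ_{m,α}`; at the exceptional points it is the finite part. -/
noncomputable def heatRieszFun [Nontrivial V] {m : ℕ} (hm : 1 ≤ m) (α : ℂ) : SmoothFun V :=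
  radialSeries V (fun k => heatCoeff V m k * diffWeight (finrank ℝ V) m α k)
    ((isEntireSeries_heatCoeff V hm).mul_bounded (exists_norm_diffWeight_le _ m α).choose_spec)

/-- The moments of a functional against the Taylor expansion of the heat kernel. -/
noncomputable def heatMoment [Nontrivial V] (m : ℕ) (T : SmoothFun V →ₗ[ℂ] ℂ) (k : ℕ) : ℂ :=
  heatCoeff V m k * T (normPow V k)

theorem summable_heatMoment [Nontrivial V] {m : ℕ} (hm : 1 ≤ m) {T : SmoothFun V →ₗ[ℂ] ℂ}
    (hT : IsRadiallyBounded T) : Summable fun k => ‖heatMoment m T k‖ :=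
  hT.summable (isEntireSeries_heatCoeff V hm)

/-- Everything about `Ψ` reduces to this scalar series: with `T ∈ ℰ'(V)` it gives meromorphy in
`ℰ(V)`, with `testPairing φ` the action as a distribution. -/
theorem apply_heatRieszFun [Nontrivial V] {m : ℕ} (hm : 1 ≤ m) {T : SmoothFun V →ₗ[ℂ] ℂ}
    (hT : IsRadiallyBounded T) (α : ℂ) :
    T (heatRieszFun V hm α) = diffSeries (finrank ℝ V) m (heatMoment m T) α := by
  rw [heatRieszFun, hT.apply_radialSeries, diffSeries]
  congr 1; ext k
  rw [heatMoment]
  ring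

theorem expPairing_normFourier_eq_tsum [Nontrivial V] {m : ℕ} (hm : 1 ≤ m) (φ : TestFun V) {t : ℝ}
    (ht : 1 ≤ t) : expPairing m (normFourier (testFunToSchwartz V φ)) t =
      ∑' k, heatMoment m (testPairing φ) k *
        ((t ^ (-(finrank ℝ V + 2 * k) / (2 * m) : ℝ) : ℝ) : ℂ) := by
  have ht0 : 0 < t := one_pos.trans_le ht
  have hb : IsEntireSeries fun k => heatCoeff V m k *
      ((t ^ (-(finrank ℝ V + 2 * k) / (2 * m) : ℝ) : ℝ) : ℂ) := by
    refine (isEntireSeries_heatCoeff V hm).mul_bounded (B := 1) fun k => ?_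
    rw [Complex.norm_real, Real.norm_of_nonneg (by positivity)]
    refine Real.rpow_le_one_of_one_le_of_nonpos ht ?_
    rw [neg_div]
    exact neg_nonpos.2 (by positivity)
  have h1 := (isRadiallyBounded_testPairing φ).apply_radialSeries hb
  have h2 : testPairing φ (radialSeries V _ hb) = ∫ v, heatKernel m t v * φ v := by
    rw [testPairing_apply]
    congr 1; ext v
    rw [← (hasSum_heatKernel hm ht0 v).tsum_eq]
    rfl
  rw [← integral_heatKernel_mul hm (testFunToSchwartz V φ) ht0, coe_testFunToSchwartz, ← h2, h1]
  congr 1; ext k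
  rw [heatMoment]
  ring

/-- Each term contributes `∫_1^∞ t^(α-1-(d+2k)/(2m)) dt = 2m/(d + 2k - 2mα)`, with `d` the
dimension. -/
theorem integral_Ioi_one_expPairing [Nontrivial V] {m : ℕ} (hm : 1 ≤ m) (φ : TestFun V) {α : ℂ}
    (hα : 2 * m * α.re < finrank ℝ V) :
    ∫ t in Ioi (1 : ℝ), (t : ℂ) ^ (α - 1) * expPairing m (normFourier (testFunToSchwartz V φ)) t =
      2 * m * poleSeries (finrank ℝ V) (heatMoment m (testPairing φ)) (2 * m * α) := by
  set d : ℝ := ((finrank ℝ V : ℕ) : ℝ) with hd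
  set w := heatMoment m (testPairing φ) with hw
  have hm0 : (0 : ℝ) < m := by exact_mod_cast hm
  have hmC : (m : ℂ) ≠ 0 := by exact_mod_cast hm0.ne'
  set a : ℕ → ℂ := fun k => α - 1 + ((-(d + 2 * k) / (2 * m) : ℝ) : ℂ) with ha
  have hare : ∀ k, (a k).re = α.re - 1 - (d + 2 * k) / (2 * m) := fun k => by
    simp only [ha, Complex.add_re, Complex.sub_re, Complex.one_re, Complex.ofReal_re]
    ring
  -- A lower bound independent of `k`, so that the integrals of the norms are summable along with
  -- `‖w k‖`.
  have hlow : ∀ k : ℕ, 0 < (d - 2 * m * α.re) / (2 * m) ∧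
      (d - 2 * m * α.re) / (2 * m) ≤ -((a k).re + 1) := fun k => by
    refine ⟨div_pos (by linarith) (by positivity), ?_⟩
    have : -((a k).re + 1) = (d - 2 * m * α.re) / (2 * m) + k / m := by
      rw [hare]; field_simp; ring
    rw [this]
    exact le_add_of_nonneg_right (by positivity)
  have hlt : ∀ k, (a k).re < -1 := fun k => by linarith [(hlow k).1, (hlow k).2]
  have hFn : ∀ k, ∫ t in Ioi (1 : ℝ), ‖w k * (t : ℂ) ^ a k‖ = ‖w k‖ * (-((a k).re + 1))⁻¹ :=
    fun k => by
    have h1 : ∀ t ∈ Ioi (1 : ℝ), ‖w k * (t : ℂ) ^ a k‖ = ‖w k‖ * t ^ (a k).re := fun t ht => by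
      rw [norm_mul, Complex.norm_cpow_eq_rpow_re_of_pos (one_pos.trans ht)]
    rw [setIntegral_congr_fun measurableSet_Ioi h1, integral_const_mul,
      integral_Ioi_rpow_of_lt (hlt k) one_pos, Real.one_rpow, inv_neg, neg_div, one_div]
  have hw_sum : Summable fun k => ‖w k‖ :=
    summable_heatMoment hm (isRadiallyBounded_testPairing φ)
  have key := hasSum_integral_of_summable_integral_norm (μ := volume.restrict (Ioi (1 : ℝ)))
    (F := fun k t => w k * (t : ℂ) ^ a k)
    (fun k => (integrableOn_Ioi_cpow_of_lt (hlt k) one_pos).const_mul _) (by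
      refine Summable.of_nonneg_of_le (fun k => integral_nonneg fun t => norm_nonneg _) (fun k => ?_)
        (hw_sum.mul_right ((d - 2 * m * α.re) / (2 * m))⁻¹)
      rw [hFn]
      exact mul_le_mul_of_nonneg_left (inv_anti₀ (hlow k).1 (hlow k).2) (norm_nonneg _))
  have e1 : ∫ t in Ioi (1 : ℝ), (t : ℂ) ^ (α - 1) *
      expPairing m (normFourier (testFunToSchwartz V φ)) t =
      ∫ t in Ioi (1 : ℝ), ∑' k, w k * (t : ℂ) ^ a k := by
    refine setIntegral_congr_fun measurableSet_Ioi fun t ht => ?_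
    have ht0 : 0 < t := one_pos.trans ht
    rw [expPairing_normFourier_eq_tsum hm φ (le_of_lt ht), ← tsum_mul_left]
    congr 1; ext k
    simp only [ha]
    rw [Complex.cpow_add _ _ (by exact_mod_cast ht0.ne'), Complex.ofReal_cpow ht0.le]
    ring
  rw [e1, ← key.tsum_eq, poleSeries, ← tsum_mul_left]
  congr 1; ext k
  rw [integral_const_mul, integral_Ioi_cpow_of_lt (hlt k) one_pos, Complex.ofReal_one,
    Complex.one_cpow]
  have h1 : a k + 1 = -(((finrank ℝ V : ℂ) + 2 * k - 2 * m * α) / (2 * m)) := by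
    simp only [ha, hd]; push_cast; field_simp; ring
  rw [h1, neg_div_neg_eq, one_div_div, div_eq_mul_inv]
  ring

/-- Split the full Mellin integral at `t = 1`: the part over `(0, 1]` is the full integral minus the
part over `(1, ∞)`. -/
theorem heatMellin_eq_radialMoment_add [Nontrivial V] {m : ℕ} (hm : 1 ≤ m) (φ : TestFun V) {α : ℂ}
    (hα0 : 0 < α.re) (hα : 2 * m * α.re < finrank ℝ V) : heatMellin m α φ =
      radialMoment (normFourier (testFunToSchwartz V φ)) (finrank ℝ V - 2 * m * α) +
        ∫ v, heatRieszFun V hm α v * φ v := by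
  set g := normFourier (testFunToSchwartz V φ) with hg
  have h1 := hasMellin_expPairing m g hα0 hα
  have hG := Complex.Gamma_ne_zero_of_re_pos hα0
  have h2 : mellin (expPairing m g) α = (∫ t in Ioc (0 : ℝ) 1, (t : ℂ) ^ (α - 1) * expPairing m g t) +
      ∫ t in Ioi (1 : ℝ), (t : ℂ) ^ (α - 1) * expPairing m g t := by
    have hc := h1.1
    rw [MellinConvergent, ← Ioc_union_Ioi_eq_Ioi zero_le_one, integrableOn_union] at hc
    rw [mellin, ← Ioc_union_Ioi_eq_Ioi zero_le_one, setIntegral_union Ioc_disjoint_Ioi_same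
      measurableSet_Ioi hc.1 hc.2]
    rfl
  rw [h1.2, integral_Ioi_one_expPairing hm φ hα] at h2
  have h3 := apply_heatRieszFun hm (isRadiallyBounded_testPairing φ) α
  rw [testPairing_apply, diffSeries_of_not_isExceptional (not_isExceptional_of_re_lt hα)] at h3
  have h4 := heatMellin_eq_integral hm (testFunToSchwartz V φ) α
  rw [coe_testFunToSchwartz] at h4
  rw [h4, h3, ← hg, eq_sub_of_add_eq h2.symm]
  field_simp
  ring

end Overlap

/-! ### The entire family, the continuation of the Riesz distributions, and the main theorem. -/

section EntireFamily

open Set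

variable {V : Type*} [NormedAddCommGroup V] [InnerProductSpace ℝ V] [FiniteDimensional ℝ V]
  [MeasurableSpace V] [BorelSpace V]

theorem re_finrank_sub_two_mul (n m : ℕ) (α : ℂ) :
    ((n : ℂ) - 2 * m * α).re = n - 2 * m * α.re := by
  rw [show (2 * m * α : ℂ) = ((2 * m : ℝ) : ℂ) * α by push_cast; ring, Complex.sub_re,
    Complex.re_ofReal_mul, Complex.natCast_re]

theorem two_mul_re_lt_of_re_nonpos [Nontrivial V] {m : ℕ} {α : ℂ} (hα : ¬ 0 < α.re) :
    2 * m * α.re < finrank ℝ V := by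
  have hd : (0 : ℝ) < finrank ℝ V := by exact_mod_cast finrank_pos
  have : 2 * (m : ℝ) * α.re ≤ 0 := mul_nonpos_of_nonneg_of_nonpos (by positivity) (not_lt.1 hα)
  linarith

variable (V) in
/-- The entire family of distributions extending `E_{m,α}`. -/
noncomputable def heatFamily [Nontrivial V] {m : ℕ} (hm : 1 ≤ m) (α : ℂ) : Distr V :=
  if h : 0 < α.re then heatMellinCLM m α h
  else radialMomentCLM (finrank ℝ V - 2 * m * α)
      (by rw [re_finrank_sub_two_mul]; linarith [two_mul_re_lt_of_re_nonpos (V := V) (m := m) h]) ∘L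
      normFourier ∘L testFunToSchwartz V + smoothDistr (heatRieszFun V hm α)

theorem heatFamily_of_pos [Nontrivial V] {m : ℕ} (hm : 1 ≤ m) {α : ℂ} (hα : 0 < α.re)
    (φ : TestFun V) : heatFamily V hm α φ = heatMellin m α φ := by
  rw [heatFamily, dif_pos hα, heatMellinCLM_apply hm]

/-- Because the two branches agree on the strip, the second formula holds on an open half-plane
containing the line `Re α = 0`, which gives differentiability across it. -/
theorem heatFamily_of_lt [Nontrivial V] {m : ℕ} (hm : 1 ≤ m) {α : ℂ}
    (hα : 2 * m * α.re < finrank ℝ V) (φ : TestFun V) : heatFamily V hm α φ =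
      radialMoment (normFourier (testFunToSchwartz V φ)) (finrank ℝ V - 2 * m * α) +
        ∫ v, heatRieszFun V hm α v * φ v := by
  by_cases h : 0 < α.re
  · rw [heatFamily_of_pos hm h, heatMellin_eq_radialMoment_add hm φ h hα]
  · rw [heatFamily, dif_neg h, ← smoothDistr_apply]
    rfl

theorem differentiable_heatFamily [Nontrivial V] {m : ℕ} (hm : 1 ≤ m) (φ : TestFun V) :
    Differentiable ℂ fun α => heatFamily V hm α φ := by
  intro α
  by_cases h : 0 < α.re
  · refine (differentiableAt_heatMellin hm (testFunToSchwartz V φ) h).congr_of_eventuallyEq ?_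
    filter_upwards [(isOpen_lt continuous_const Complex.continuous_re).mem_nhds h] with z hz
    exact heatFamily_of_pos hm hz φ
  · have h1 := two_mul_re_lt_of_re_nonpos (V := V) (m := m) h
    have h2 : DifferentiableAt ℂ (fun z : ℂ =>
        radialMoment (normFourier (testFunToSchwartz V φ)) (finrank ℝ V - 2 * m * z) +
          diffSeries (finrank ℝ V) m (heatMoment m (testPairing φ)) z) α := by
      refine DifferentiableAt.add ?_ (analyticAt_diffSeries
        (summable_heatMoment hm (isRadiallyBounded_testPairing φ))
        (not_isExceptional_of_re_lt h1)).differentiableAt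
      refine DifferentiableAt.fun_comp' (f := fun z : ℂ => (finrank ℝ V : ℂ) - 2 * m * z) α
        (differentiableAt_radialMoment _ ?_) (by fun_prop)
      rw [re_finrank_sub_two_mul]
      linarith
    refine h2.congr_of_eventuallyEq ?_
    have hopen : IsOpen {z : ℂ | 2 * m * z.re < finrank ℝ V} :=
      isOpen_lt (by fun_prop) continuous_const
    filter_upwards [hopen.mem_nhds h1] with z hz
    rw [heatFamily_of_lt hm hz, ← apply_heatRieszFun hm (isRadiallyBounded_testPairing φ),
      testPairing_apply]

theorem isEntireExtension_heatFamily [Nontrivial V] {m : ℕ} (hm : 1 ≤ m) :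
    IsEntireExtension m (heatFamily V hm) :=
  ⟨differentiable_heatFamily hm, fun _ hα φ => heatFamily_of_pos hm hα φ⟩

theorem IsEntireExtension.unique {m : ℕ} {E E' : ℂ → Distr V} (hE : IsEntireExtension m E)
    (hE' : IsEntireExtension m E') : E = E' := by
  ext α φ
  have h1 : AnalyticOnNhd ℂ (fun z => E z φ) univ := fun z _ => (hE.1 φ).analyticAt z
  have h2 : AnalyticOnNhd ℂ (fun z => E' z φ) univ := fun z _ => (hE'.1 φ).analyticAt z
  refine h1.eqOn_of_preconnected_of_eventuallyEq h2 isPreconnected_univ (mem_univ 1) ?_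
    (mem_univ α)
  filter_upwards [(isOpen_lt continuous_const Complex.continuous_re).mem_nhds
    (by simp : (0 : ℝ) < (1 : ℂ).re)] with z hz
  rw [hE.2 z hz φ, hE'.2 z hz φ]

theorem meromorphicAt_rieszConst (n : ℕ) (w : ℂ) : MeromorphicAt (rieszConst n) w := by
  have hG : ∀ f : ℂ → ℂ, Differentiable ℂ f → MeromorphicAt (fun z => Complex.Gamma (f z)) w :=
    fun f hf => by
      -- `Γ` is meromorphic as the inverse of the entire function `1/Γ`.
      have : (fun z => Complex.Gamma (f z)) = (fun z => (Complex.Gamma (f z))⁻¹)⁻¹ := by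
        ext z; simp
      rw [this]
      exact (((Complex.differentiable_one_div_Gamma.comp hf).analyticAt w).meromorphicAt).inv
  have h2 : Differentiable ℂ fun z : ℂ => (2 : ℂ) ^ z := fun z =>
    (hasDerivAt_id z).const_cpow (Or.inl two_ne_zero) |>.differentiableAt
  exact (hG _ (by fun_prop)).div (((h2.analyticAt w).meromorphicAt.mul
    (MeromorphicAt.const _ w)).mul (hG _ (by fun_prop)))

/-- The identity theorem yields equalities on punctured neighbourhoods only; continuity carries them
to the point itself. -/
theorem continuousAt_rieszConst {n : ℕ} {w : ℂ} (hw : 0 < w.re) (h : ∀ k : ℕ, w ≠ n + 2 * k) :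
    ContinuousAt (rieszConst n) w := by
  have h1 : ContinuousAt (fun z : ℂ => Complex.Gamma ((n - z) / 2)) w := by
    refine ContinuousAt.comp' (f := fun z : ℂ => ((n : ℂ) - z) / 2)
      (Complex.differentiableAt_Gamma _ fun k hk => h k ?_).continuousAt (by fun_prop)
    rw [div_eq_iff two_ne_zero] at hk
    linear_combination -hk
  have h2 : ContinuousAt (fun z : ℂ => Complex.Gamma (z / 2)) w := by
    refine ContinuousAt.comp' (f := fun z : ℂ => z / 2)
      (Complex.differentiableAt_Gamma _ fun k hk => ?_).continuousAt (by fun_prop)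
    have := congrArg Complex.re hk
    rw [Complex.div_ofNat_re, Complex.neg_re, Complex.natCast_re] at this
    have : (0 : ℝ) ≤ k := Nat.cast_nonneg k
    linarith
  have h3 : ContinuousAt (fun z : ℂ => (2 : ℂ) ^ z) w :=
    ((hasDerivAt_id w).const_cpow (Or.inl two_ne_zero)).continuousAt
  have hpi : (Real.pi : ℂ) ≠ 0 := by exact_mod_cast Real.pi_ne_zero
  refine h1.div ((h3.mul continuousAt_const).mul h2) (mul_ne_zero (mul_ne_zero ?_ ?_) ?_)
  · simp [Complex.cpow_eq_zero_iff]
  · simp [Complex.cpow_eq_zero_iff, hpi]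
  · exact Complex.Gamma_ne_zero_of_re_pos (by rw [Complex.div_ofNat_re]; linarith)

theorem integral_rieszPotential_mul (w : ℂ) (ψ : V → ℂ) :
    ∫ v, rieszPotential w v * ψ v = rieszConst (finrank ℝ V) w * radialMoment ψ w := by
  rw [radialMoment, ← integral_const_mul]
  congr 1; ext v
  rw [rieszPotential, mul_assoc]

/-- A meromorphic function on a connected set which vanishes near one point vanishes near all
points, apart from the points themselves. -/
theorem MeromorphicOn.eventually_eq_zero {f : ℂ → ℂ} {U : Set ℂ} (hf : MeromorphicOn f U)
    (hU : IsConnected U) {x y : ℂ} (hx : x ∈ U) (hy : y ∈ U) (h : ∀ᶠ z in 𝓝[≠] x, f z = 0) :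
    ∀ᶠ z in 𝓝[≠] y, f z = 0 := by
  rw [← meromorphicOrderAt_eq_top_iff] at h ⊢
  by_contra hne
  exact (hf.exists_meromorphicOrderAt_ne_top_iff_forall hU).1 ⟨⟨y, hy⟩, hne⟩ ⟨x, hx⟩ h

theorem isConnected_re_gt (c : ℝ) : IsConnected {z : ℂ | c < z.re} :=
  ⟨⟨(c + 1 : ℝ), by simp⟩, (convex_halfSpace_re_gt c).isPreconnected⟩

/-- Both sides are meromorphic on `Re z > -2k`. On the strip `0 < Re z + 2k < n` the Fourier
transform of the Riesz potential, with `Δ^k` turned into `|ξ|^(2k)`, shows that they agree; the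
identity theorem then reaches `β`. -/
theorem eventually_rieszPotential_eq [Nontrivial V] {m : ℕ} (hm : 1 ≤ m) (φ : TestFun V) (k : ℕ)
    {β : ℂ} (hβ : -(2 * k) < β.re) : ∀ᶠ z in 𝓝[≠] β,
      ∫ v, rieszPotential (z + 2 * k) v * (posLaplacian^[k] φ) v =
        heatFamily V hm (z / (2 * m)) φ -
          diffSeries (finrank ℝ V) m (heatMoment m (testPairing φ)) (z / (2 * m)) := by
  have hd : (0 : ℝ) < finrank ℝ V := by exact_mod_cast finrank_pos
  have hmC : (m : ℂ) ≠ 0 := by exact_mod_cast (by omega : m ≠ 0)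
  set ψ := negLaplacian^[k] (testFunToSchwartz V φ) with hψ
  have hcoe : posLaplacian^[k] φ = ⇑ψ := (coe_iterate_negLaplacian k (testFunToSchwartz V φ)).symm
  simp only [hcoe, integral_rieszPotential_mul]
  have hmul : ∀ z : ℂ, 2 * m * (z / (2 * m)) = z := fun z => by field_simp
  set D : ℂ → ℂ := fun z => rieszConst (finrank ℝ V) (z + 2 * k) * radialMoment ψ (z + 2 * k) -
    (heatFamily V hm (z / (2 * m)) φ -
      diffSeries (finrank ℝ V) m (heatMoment m (testPairing φ)) (z / (2 * m))) with hD
  have hlin : ∀ z : ℂ, AnalyticAt ℂ (fun z : ℂ => z / (2 * m)) z := fun z => by fun_prop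
  have hmer : MeromorphicOn D {z | -(2 * k : ℝ) < z.re} := fun z hz => by
    refine MeromorphicAt.sub (MeromorphicAt.mul ?_ ?_) (MeromorphicAt.sub ?_ ?_)
    · refine (meromorphicAt_rieszConst _ (z + 2 * k)).comp_analyticAt
        (g := fun z : ℂ => z + 2 * k) (by fun_prop)
    · refine AnalyticAt.meromorphicAt ?_
      have hopen : IsOpen {z : ℂ | -(2 * k : ℝ) < z.re} :=
        isOpen_lt continuous_const Complex.continuous_re
      refine DifferentiableOn.analyticAt (s := {z : ℂ | -(2 * k : ℝ) < z.re}) (fun y hy => ?_)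
        (hopen.mem_nhds hz)
      refine (DifferentiableAt.fun_comp' (f := fun z : ℂ => z + 2 * k) y
        (differentiableAt_radialMoment _ ?_) (by fun_prop)).differentiableWithinAt
      have : -(2 * k : ℝ) < y.re := hy
      rw [show (y + 2 * k : ℂ) = y + ((2 * k : ℝ) : ℂ) by push_cast; ring, Complex.add_re,
        Complex.ofReal_re]
      linarith
    · exact (((differentiable_heatFamily hm φ).comp (by fun_prop :
        Differentiable ℂ fun z : ℂ => z / (2 * m))).analyticAt z).meromorphicAt
    · exact (meromorphic_diffSeries hm (summable_heatMoment hm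
        (isRadiallyBounded_testPairing φ)) _).comp_analyticAt
        (g := fun z : ℂ => z / (2 * m)) (hlin z)
  -- The real midpoint of the strip.
  set x : ℂ := ((finrank ℝ V / 2 - 2 * k : ℝ) : ℂ) with hx
  have hstrip : IsOpen {z : ℂ | 0 < z.re + 2 * k ∧ z.re + 2 * k < finrank ℝ V} :=
    isOpen_Ioo.preimage (Complex.continuous_re.add continuous_const)
  have hx_mem : x ∈ {z : ℂ | 0 < z.re + 2 * k ∧ z.re + 2 * k < finrank ℝ V} := by
    simp only [mem_ofPred_eq, hx, Complex.ofReal_re]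
    constructor <;> linarith
  have hzero : ∀ᶠ z in 𝓝[≠] x, D z = 0 := by
    refine nhdsWithin_le_nhds ?_
    filter_upwards [hstrip.mem_nhds hx_mem] with z hz
    have hk0 : (0 : ℝ) ≤ k := Nat.cast_nonneg k
    have hre : (z + 2 * k : ℂ).re = z.re + 2 * k := by
      rw [show (z + 2 * k : ℂ) = z + ((2 * k : ℝ) : ℂ) by push_cast; ring, Complex.add_re,
        Complex.ofReal_re]
    have hlt : 2 * m * (z / (2 * m)).re < finrank ℝ V := by
      have h1 := re_finrank_sub_two_mul (finrank ℝ V) m (z / (2 * m))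
      rw [hmul, Complex.sub_re, Complex.natCast_re] at h1
      linarith [hz.2]
    have h2 := apply_heatRieszFun hm (isRadiallyBounded_testPairing φ) (z / (2 * m))
    rw [testPairing_apply] at h2
    simp only [hD]
    rw [heatFamily_of_lt hm hlt, ← h2, hmul, add_sub_cancel_right,
      rieszConst_mul_radialMoment ψ (by rw [hre]; exact hz.1) (by rw [hre]; exact hz.2), hψ,
      radialMoment_normFourier_iterate_negLaplacian, sub_eq_zero]
    congr 1
    ring
  have hfin := hmer.eventually_eq_zero (isConnected_re_gt _) (x := x) (y := β)
    (by have := hx_mem.1; simp only [mem_ofPred_eq]; linarith) hβ hzero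
  filter_upwards [hfin] with z hz using sub_eq_zero.1 hz

/-- For `Re > 0` the Riesz side is a value, and its continuity must be checked. Otherwise it is a
punctured limit, read off from the other side, which is continuous; this also covers the removable
singularities. -/
theorem rieszDistribution_eq [Nontrivial V] {m : ℕ} (hm : 1 ≤ m) (φ : TestFun V) {α : ℂ}
    (hα : ¬ IsExceptional (finrank ℝ V) m α) : rieszDistribution (2 * m * α) φ =
      heatFamily V hm α φ - diffSeries (finrank ℝ V) m (heatMoment m (testPairing φ)) α := by
  have hmC : (m : ℂ) ≠ 0 := by exact_mod_cast (by omega : m ≠ 0)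
  have hmul : 2 * m * α / (2 * m) = α := by field_simp
  have hlim : Tendsto (fun z : ℂ => heatFamily V hm (z / (2 * m)) φ -
      diffSeries (finrank ℝ V) m (heatMoment m (testPairing φ)) (z / (2 * m)))
      (𝓝[≠] (2 * m * α)) (𝓝 (heatFamily V hm α φ -
        diffSeries (finrank ℝ V) m (heatMoment m (testPairing φ)) α)) := by
    have h1 : ContinuousAt (fun y : ℂ => heatFamily V hm y φ -
        diffSeries (finrank ℝ V) m (heatMoment m (testPairing φ)) y) α :=
      (differentiable_heatFamily hm φ α).continuousAt.sub (analyticAt_diffSeries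
        (summable_heatMoment hm (isRadiallyBounded_testPairing φ)) hα).continuousAt
    have h2 : Tendsto (fun z : ℂ => z / (2 * m)) (𝓝 (2 * m * α)) (𝓝 α) := by
      have : ContinuousAt (fun z : ℂ => z / (2 * m)) (2 * m * α) := by fun_prop
      rwa [ContinuousAt, hmul] at this
    exact (h1.tendsto.comp h2).mono_left nhdsWithin_le_nhds
  rw [rieszDistribution]
  split_ifs with h
  · have h1 := eventually_rieszPotential_eq hm φ 0 (β := 2 * m * α) (by simpa using h)
    simp only [Nat.cast_zero, mul_zero, add_zero, Function.iterate_zero, id,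
      integral_rieszPotential_mul] at h1
    rw [integral_rieszPotential_mul]
    have h2 : ContinuousAt (fun z => rieszConst (finrank ℝ V) z * radialMoment φ z) (2 * m * α) :=
      (continuousAt_rieszConst h fun k hk => hα ⟨k, hk⟩).mul
        (differentiableAt_radialMoment (testFunToSchwartz V φ) h).continuousAt
    exact tendsto_nhds_unique (h2.tendsto.mono_left nhdsWithin_le_nhds)
      (hlim.congr' (h1.mono fun z hz => hz.symm))
  · refine Tendsto.limUnder_eq (hlim.congr' ?_)
    -- This says that the number `k` of Laplacians satisfies `-2k < Re(2mα)`.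
    have h1 := Nat.lt_floor_add_one (-(2 * m * α).re / 2)
    refine (eventually_rieszPotential_eq hm φ _ ?_).mono fun z hz => hz.symm
    push_cast
    linarith

theorem heatRieszDiff_eq [Nontrivial V] {m : ℕ} (hm : 1 ≤ m) (φ : TestFun V) {α : ℂ}
    (hα : ¬ IsExceptional (finrank ℝ V) m α) : heatRieszDiff m (heatFamily V hm) α φ =
      diffSeries (finrank ℝ V) m (heatMoment m (testPairing φ)) α := by
  rw [heatRieszDiff, rieszDistribution_eq hm φ hα, sub_sub_cancel]

theorem hasFinitePartAt_heatRieszDiff [Nontrivial V] {m : ℕ} (hm : 1 ≤ m) (φ : TestFun V) {α : ℂ}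
    (hα : IsExceptional (finrank ℝ V) m α) :
    HasFinitePartAt (fun β => heatRieszDiff m (heatFamily V hm) β φ) α
      (diffSeries (finrank ℝ V) m (heatMoment m (testPairing φ)) α) := by
  obtain ⟨c, g, hg, hgα, hiso, h⟩ := exists_diffSeries_eq_of_isExceptional hm
    (summable_heatMoment hm (isRadiallyBounded_testPairing φ)) hα
  refine ⟨Polynomial.C c * Polynomial.X, g, by simp, hg, hgα, ?_⟩
  filter_upwards [hiso, h] with z hz hz'
  rw [heatRieszDiff_eq hm φ hz, hz']
  simp

theorem heatRieszFun_zero [Nontrivial V] {m : ℕ} (hm : 1 ≤ m) {α : ℂ}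
    (hα : ¬ IsExceptional (finrank ℝ V) m α) : heatRieszFun V hm α 0 =
      Complex.Gamma ((finrank ℝ V : ℂ) / (2 * m)) /
          (((4 * Real.pi : ℝ) : ℂ) ^ ((finrank ℝ V : ℂ) / 2) *
            Complex.Gamma ((finrank ℝ V : ℂ) / 2) * Complex.Gamma α) *
        (1 / (m * α - (finrank ℝ V : ℂ) / 2)) := by
  have hmC : (m : ℂ) ≠ 0 := by exact_mod_cast (by omega : m ≠ 0)
  have h0 : ¬ (2 * m * α = finrank ℝ V + 2 * (0 : ℕ)) := fun h => hα ⟨0, h⟩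
  have h1 : heatRieszFun V hm α 0 = heatCoeff V m 0 * diffWeight (finrank ℝ V) m α 0 := by
    change ∑' k, heatCoeff V m k * diffWeight (finrank ℝ V) m α k * ((‖(0 : V)‖ ^ 2 : ℝ) : ℂ) ^ k = _
    rw [tsum_eq_single 0 fun k hk => by simp [hk]]
    simp
  have h2 : (m * α - (finrank ℝ V : ℂ) / 2) ≠ 0 := fun h => h0 (by push_cast; linear_combination 2 * h)
  have h3 : ((finrank ℝ V : ℂ) + 2 * (0 : ℕ) - 2 * m * α)⁻¹ =
      -(1 / 2) * (1 / (m * α - (finrank ℝ V : ℂ) / 2)) := by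
    rw [show (finrank ℝ V : ℂ) + 2 * (0 : ℕ) - 2 * m * α = -2 * (m * α - (finrank ℝ V : ℂ) / 2) by
      push_cast; ring, mul_inv, one_div, one_div]
    norm_num
  rw [h1, diffWeight, if_neg h0, heatCoeff_zero hm, h3, div_mul_eq_div_div _ _ (Complex.Gamma α),
    div_mul_eq_div_div _ _ (m : ℂ), div_eq_mul_inv _ (Complex.Gamma α)]
  generalize (m * α - (finrank ℝ V : ℂ) / 2) = x at h2
  generalize Complex.Gamma α = a
  generalize Complex.Gamma ((finrank ℝ V : ℂ) / 2) = b
  field_simp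
  ring

end EntireFamily

theorem mainTheorem7 {V : Type*} [NormedAddCommGroup V] [InnerProductSpace ℝ V]
    [FiniteDimensional ℝ V] [MeasurableSpace V] [BorelSpace V]
    (n : ℕ) (hn : Module.finrank ℝ V = n) (hn2 : 2 ≤ n) (m : ℕ) (hm : 1 ≤ m) :
    (∀ α : ℂ, 0 < α.re → ∀ φ : TestFun V,
      IntervalIntegrable (heatIntegrand m α φ) volume 0 1) ∧
    (∃! E : ℂ → Distr V, IsEntireExtension m E) ∧
    ∀ E : ℂ → Distr V, IsEntireExtension m E →
      ∃ Ψ : ℂ → SmoothFun V,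
        (∀ α : ℂ, ¬ IsExceptional n m α → ∀ φ : TestFun V,
          heatRieszDiff m E α φ = ∫ v, Ψ α v * φ v) ∧
        (∀ α : ℂ, IsExceptional n m α → ∀ φ : TestFun V,
          HasFinitePartAt (fun β => heatRieszDiff m E β φ) α (∫ v, Ψ α v * φ v)) ∧
        (∀ T : CompactDistribution V,
          MeromorphicOn (fun α => T (Ψ α)) Set.univ ∧
          ∀ α : ℂ, ¬ IsExceptional n m α → AnalyticAt ℂ (fun β => T (Ψ β)) α) ∧
        ∀ α : ℂ, ¬ IsExceptional n m α →
          Ψ α 0 = diracZero V (Ψ α) ∧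
          Ψ α 0 = Complex.Gamma ((n : ℂ) / (2 * m)) /
              (((4 * Real.pi : ℝ) : ℂ) ^ ((n : ℂ) / 2) * Complex.Gamma ((n : ℂ) / 2) *
                Complex.Gamma α) *
            (1 / (m * α - (n : ℂ) / 2)) := by
  subst hn
  have : Nontrivial V := Module.nontrivial_of_finrank_pos (R := ℝ) (by omega)
  refine ⟨fun α hα φ => intervalIntegrable_heatIntegrand hm (testFunToSchwartz V φ) hα,
    ⟨heatFamily V hm, isEntireExtension_heatFamily hm,
      fun E hE => hE.unique (isEntireExtension_heatFamily hm)⟩, fun E hE => ?_⟩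
  -- By uniqueness it suffices to treat the family constructed above.
  obtain rfl := hE.unique (isEntireExtension_heatFamily hm)
  have hpair : ∀ (α : ℂ) (φ : TestFun V), ∫ v, heatRieszFun V hm α v * φ v =
      diffSeries (finrank ℝ V) m (heatMoment m (testPairing φ)) α := fun α φ =>
    apply_heatRieszFun hm (isRadiallyBounded_testPairing φ) α
  -- A single function serves all `α`: the weights `diffWeight` already contain the finite part at
  -- the exceptional points.
  refine ⟨heatRieszFun V hm, fun α hα φ => ?_, fun α hα φ => ?_, fun T => ?_,
    fun α hα => ⟨rfl, heatRieszFun_zero hm hα⟩⟩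
  · rw [hpair, heatRieszDiff_eq hm φ hα]
  · rw [hpair]
    exact hasFinitePartAt_heatRieszDiff hm φ hα
  · have hT : (fun α => T (heatRieszFun V hm α)) =
        diffSeries (finrank ℝ V) m (heatMoment m (T : SmoothFun V →ₗ[ℂ] ℂ)) :=
      funext fun α => apply_heatRieszFun hm T.isRadiallyBounded α
    rw [hT]
    exact ⟨fun α _ => meromorphic_diffSeries hm (summable_heatMoment hm T.isRadiallyBounded) α,
      fun α hα => analyticAt_diffSeries (summable_heatMoment hm T.isRadiallyBounded) hα⟩
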